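/- **Setting.** Let $\Omega\subset\mathbb R^d$ ($d\ge 1$) be a bounded open set with Lipschitz boundary, and let $\partial_u\Omega\neq\emptyset$ and $\partial_q\Omega$ be disjoint measurable subsets of $\partial\Omega$ with $\overline{\partial_u\Omega\cup\partial_q\Omega}=\partial\Omega$. Let $I=[0,T]$ with $T>0$, let $\mathcal V=\{v\in H^1(\Omega): v=0 \text{ on } \partial_u\Omega\}$, and let $P\subset\mathbb R^{n_p}$ be a set of parameters. For each $p\in P$ let $c,k,r\in L^\infty(\Omega)$ be coefficients (depending on $p$) with $c\ge c_0>0$, $k\ge k_0>0$ and $r\ge 0$ a.e. in $\Omega$. Let $f_d\in L^2(I;L^2(\Omega))$, $g_d\in L^2(I;L^2(\partial_q\Omega))$, and (possibly depending on $p$) $q_\Sigma\in L^2(I;L^2(\Omega)^d)$, $f_\Sigma\in L^2(I;L^2(\Omega))$. Let $W$ be the space of all $v\in L^2(I;\mathcal V)$ with $c\,\partial_t v\in L^2(I;\mathcal V^*)$, where the duality pairing extends the inner product of $L^2(\Omega)$; its elements have representatives in $C(I;L^2(\Omega))$, which give the values at $t=0$ and $t=T$. Integrals of $c\,\partial_t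 v\,w$ over $\Omega$ denote this pairing. Quotients $a^2/r$ at points where $r=0$ are $0$ if $a=0$ and $+\infty$ otherwise (in products, $\frac1r\cdot 0\cdot 0=0$ there). Put $$b(u,v)=\int_I\int_\Omega (c\,\partial_t u\,v+k\nabla u\cdot\nabla v+r\,u\,v)\,d\Omega\,dt,\qquad l(v)=\int_I\Big(\int_\Omega f_d v\,d\Omega+\int_{\partial_q\Omega} g_d v\,dS\Big)dt,$$ $$Q(v)=\int_I\int_\Omega (q_\Sigma\cdot\nabla v+f_\Sigma v)\,d\Omega\,dt .$$ For each $p\in P$ let $u\in W$ with $u|_{t=0}=0$ and $b(u,v)=l(v)$ for all $v\in L^2(I;\mathcal V)$. **Admissible triplets.** For each $p\in P$ let $(u_m,\hat q_m,\hat z_m)$ and $(\tilde u_{m'},\hat{\tilde q}_{m'},\hat{\tilde z}_{m'})$ be elements of $W\times L^2(I;L^2(\Omega)^d)\times L^2(I;L^2(\Omega))$ such that $u_m|_{t=0}=0$, $\tilde u_{m'}|_{t=T}=0$ and, for a.e. $t\in I$ and all $v\in\mathcal V$, $$\int_\Omega (c\,\partial_t u_m v+\hat q_m\cdot\nabla v+\hat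 z_m v)\,d\Omega=\int_\Omega f_d v\,d\Omega+\int_{\partial_q\Omega}g_d v\,dS,$$ $$\int_\Omega (-c\,\partial_t \tilde u_{m'} v+\hat{\tilde q}_{m'}\cdot\nabla v+\hat{\tilde z}_{m'} v)\,d\Omega=\int_\Omega (q_\Sigma\cdot\nabla v+f_\Sigma v)\,d\Omega$$ (the second equation is the equilibrium of the backward-in-time adjoint problem). Define $$E_{\rm CRE}^2=\int_I\int_\Omega\Big(\tfrac1k|\hat q_m-k\nabla u_m|^2+\tfrac1r(\hat z_m-r u_m)^2\Big)d\Omega\,dt,\qquad \tilde E_{\rm CRE}^2=\int_I\int_\Omega\Big(\tfrac1k|\hat{\tilde q}_{m'}-k\nabla\tilde u_{m'}|^2+\tfrac1r(\hat{\tilde z}_{m'}-r\tilde u_{m'})^2\Big)d\Omega\,dt,$$ and assume that both are finite. Let $\Delta Q=Q(u)-Q(u_m)$, $R(v)=l(v)-b(u_m,v)$, let $$(\hat q_m^*,\hat z_m^*)=\tfrac12\big[(\hat q_m,\hat z_m)+(k\nabla u_m,ru_m)\big],\qquad (\hat{\tilde q}{}_{m'}^{*},\hat{\tilde z}{}_{m'}^{*})=\tfrac12\big[(\hat{\tilde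 q}_{m'},\hat{\tilde z}_{m'})+(k\nabla\tilde u_{m'},r\tilde u_{m'})\big],$$ and $$Q_{\rm corr}=\int_I\int_\Omega\Big(\tfrac1k(\hat q_m-k\nabla u_m)\cdot\hat{\tilde q}{}_{m'}^{*}+\tfrac1r(\hat z_m-ru_m)\,\hat{\tilde z}{}_{m'}^{*}\Big)d\Omega\,dt .$$ **Claim.** For every $p\in P$, $$|\Delta Q-R(\tilde u_{m'})|\le \tilde E_{\rm CRE}\,E_{\rm CRE},$$ $$Q_{\rm corr}=R(\tilde u_{m'})+\int_I\int_\Omega\Big(\tfrac1k(\hat{\tilde q}_{m'}-k\nabla\tilde u_{m'})\cdot(\hat q_m^*-k\nabla u_m)+\tfrac1r(\hat{\tilde z}_{m'}-r\tilde u_{m'})(\hat z_m^*-ru_m)\Big)d\Omega\,dt,$$ $$|Q(u)-Q(u_m)-Q_{\rm corr}|\le \tfrac12\,\tilde E_{\rm CRE}\,E_{\rm CRE}.$$ -/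

import Mathlib

open MeasureTheory Set Topology
open scoped ENNReal NNReal ContDiff RealInnerProductSpace

noncomputable section

namespace ParabolicCRE

/-- The Euclidean space `ℝ^d`. -/
abbrev E (d : ℕ) : Type := EuclideanSpace ℝ (Fin d)

variable {d : ℕ}

/-! ### The space domain, its boundary and the Sobolev space -/

/-- The boundary of `Ω` is locally the graph of a Lipschitz function, with `Ω` on one side of it:
near each boundary point there are a unit vector `e` and a Lipschitz function `γ` of the component
of `x` orthogonal to `e` such that `Ω` is given by `γ < ⟪e, x⟫`. -/
def HasLipschitzBoundary (Ω : Set (E d)) : Prop :=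
  ∀ x₀ ∈ frontier Ω, ∃ (e : E d) (ρ : ℝ) (K : ℝ≥0) (γ : E d → ℝ),
    ‖e‖ = 1 ∧ 0 < ρ ∧ LipschitzWith K γ ∧
      ∀ x ∈ Metric.ball x₀ ρ, x ∈ Ω ↔ γ (x - ⟪e, x⟫ • e) < ⟪e, x⟫

/-- The surface measure of `∂Ω`: the `(d - 1)`-dimensional Hausdorff measure (with the Euclidean
normalization) restricted to the boundary. -/
def surfaceMeasure (Ω : Set (E d)) : Measure (E d) :=
  (μHE[d - 1] : Measure (E d)).restrict (frontier Ω)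

/-- `L²(Ω)`. -/
abbrev L2 (Ω : Set (E d)) : Type := Lp ℝ 2 (volume.restrict Ω)

/-- `L²(Ω)^d`. -/
abbrev L2Vec (Ω : Set (E d)) : Type := Lp (E d) 2 (volume.restrict Ω)

/-- `g` is the weak gradient of `v` in `Ω`. -/
def IsWeakGradient (Ω : Set (E d)) (v : L2 Ω) (g : L2Vec Ω) : Prop :=
  ∀ φ : E d → ℝ, ContDiff ℝ ∞ φ → HasCompactSupport φ → tsupport φ ⊆ Ω → ∀ e : E d,
    ∫ x in Ω, v x * fderiv ℝ φ x e = - ∫ x in Ω, ⟪g x, e⟫ * φ x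

theorem integrable_testDeriv {Ω : Set (E d)} (v : L2 Ω) {φ : E d → ℝ} (hφ : ContDiff ℝ ∞ φ)
    (hc : HasCompactSupport φ) (e : E d) :
    Integrable (fun x => v x * fderiv ℝ φ x e) (volume.restrict Ω) := by
  have hcont : Continuous (fun x => fderiv ℝ φ x e) :=
    (hφ.continuous_fderiv (by simp)).clm_apply continuous_const
  have hsupp : HasCompactSupport (fun x => fderiv ℝ φ x e) := hc.fderiv_apply (𝕜 := ℝ) e
  exact (Lp.memLp v).integrable_mul (q := 2) (hcont.memLp_of_hasCompactSupport hsupp)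

theorem integrable_gradTest {Ω : Set (E d)} (g : L2Vec Ω) {φ : E d → ℝ} (hφ : ContDiff ℝ ∞ φ)
    (hc : HasCompactSupport φ) (e : E d) :
    Integrable (fun x => ⟪g x, e⟫ * φ x) (volume.restrict Ω) := by
  have h1 : MemLp (fun x => ⟪g x, e⟫) 2 (volume.restrict Ω) := (Lp.memLp g).inner_const e
  exact h1.integrable_mul (q := 2) (hφ.continuous.memLp_of_hasCompactSupport hc)

/-- The pairs `(v, ∇v)` in `L²(Ω) × L²(Ω)^d` whose second component is the weak gradient of the
first. -/
def h1Submodule (Ω : Set (E d)) : Submodule ℝ (WithLp 2 (L2 Ω × L2Vec Ω)) where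
  carrier := {p | IsWeakGradient Ω p.fst p.snd}
  zero_mem' := by
    intro φ _ _ _ e
    have h1 : ∫ x in Ω, (0 : L2 Ω) x * fderiv ℝ φ x e = 0 := by
      rw [integral_eq_zero_of_ae]
      filter_upwards [Lp.coeFn_zero ℝ 2 (volume.restrict Ω)] with x hx
      rw [hx]; simp
    have h2 : ∫ x in Ω, ⟪(0 : L2Vec Ω) x, e⟫ * φ x = 0 := by
      rw [integral_eq_zero_of_ae]
      filter_upwards [Lp.coeFn_zero (E d) 2 (volume.restrict Ω)] with x hx
      rw [hx]; simp
    change ∫ x in Ω, (0 : L2 Ω) x * fderiv ℝ φ x e = - ∫ x in Ω, ⟪(0 : L2Vec Ω) x, e⟫ * φ x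
    rw [h1, h2, neg_zero]
  add_mem' := by
    intro p q hp hq φ hφ hc hs e
    have h1 : ∫ x in Ω, (p.fst + q.fst : L2 Ω) x * fderiv ℝ φ x e
        = (∫ x in Ω, p.fst x * fderiv ℝ φ x e) + ∫ x in Ω, q.fst x * fderiv ℝ φ x e := by
      rw [← integral_add (integrable_testDeriv _ hφ hc e) (integrable_testDeriv _ hφ hc e)]
      refine integral_congr_ae ?_
      filter_upwards [Lp.coeFn_add p.fst q.fst] with x hx
      rw [hx, Pi.add_apply, add_mul]
    have h2 : ∫ x in Ω, ⟪(p.snd + q.snd : L2Vec Ω) x, e⟫ * φ x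
        = (∫ x in Ω, ⟪p.snd x, e⟫ * φ x) + ∫ x in Ω, ⟪q.snd x, e⟫ * φ x := by
      rw [← integral_add (integrable_gradTest _ hφ hc e) (integrable_gradTest _ hφ hc e)]
      refine integral_congr_ae ?_
      filter_upwards [Lp.coeFn_add p.snd q.snd] with x hx
      rw [hx, Pi.add_apply, inner_add_left, add_mul]
    change ∫ x in Ω, (p.fst + q.fst : L2 Ω) x * fderiv ℝ φ x e
        = - ∫ x in Ω, ⟪(p.snd + q.snd : L2Vec Ω) x, e⟫ * φ x
    rw [h1, h2, hp φ hφ hc hs e, hq φ hφ hc hs e]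
    ring
  smul_mem' := by
    intro a p hp φ hφ hc hs e
    have h1 : ∫ x in Ω, (a • p.fst : L2 Ω) x * fderiv ℝ φ x e
        = a * ∫ x in Ω, p.fst x * fderiv ℝ φ x e := by
      rw [← integral_const_mul]
      refine integral_congr_ae ?_
      filter_upwards [Lp.coeFn_smul a p.fst] with x hx
      rw [hx, Pi.smul_apply, smul_eq_mul, mul_assoc]
    have h2 : ∫ x in Ω, ⟪(a • p.snd : L2Vec Ω) x, e⟫ * φ x
        = a * ∫ x in Ω, ⟪p.snd x, e⟫ * φ x := by
      rw [← integral_const_mul]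
      refine integral_congr_ae ?_
      filter_upwards [Lp.coeFn_smul a p.snd] with x hx
      rw [hx, Pi.smul_apply, inner_smul_left, mul_assoc]; rfl
    change ∫ x in Ω, (a • p.fst : L2 Ω) x * fderiv ℝ φ x e
        = - ∫ x in Ω, ⟪(a • p.snd : L2Vec Ω) x, e⟫ * φ x
    rw [h1, h2, hp φ hφ hc hs e]
    ring

/-- The Sobolev space `H¹(Ω)`: pairs `(v, ∇v)` with the Hilbert norm `(‖v‖² + ‖∇v‖²)^(1/2)`. -/
def H1 (Ω : Set (E d)) : Type := ↥(h1Submodule Ω)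

instance (Ω : Set (E d)) : NormedAddCommGroup (H1 Ω) :=
  inferInstanceAs (NormedAddCommGroup ↥(h1Submodule Ω))

instance (Ω : Set (E d)) : InnerProductSpace ℝ (H1 Ω) :=
  inferInstanceAs (InnerProductSpace ℝ ↥(h1Submodule Ω))

/-- The function underlying an element of `H¹(Ω)`. -/
def H1.fn {Ω : Set (E d)} (v : H1 Ω) : L2 Ω := v.1.fst

/-- The weak gradient of an element of `H¹(Ω)`. -/
def H1.grad {Ω : Set (E d)} (v : H1 Ω) : L2Vec Ω := v.1.snd

/-- `τ` is the trace operator `H¹(Ω) → L²(∂Ω)`: the continuous linear map that restricts to the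
boundary every function which is smooth up to the boundary. -/
def IsTraceOperator (Ω : Set (E d)) (τ : H1 Ω →L[ℝ] Lp ℝ 2 (surfaceMeasure Ω)) : Prop :=
  ∀ φ : E d → ℝ, ContDiff ℝ ∞ φ → ∀ v : H1 Ω,
    (v.fn =ᵐ[volume.restrict Ω] φ) → (τ v =ᵐ[surfaceMeasure Ω] φ)

open Classical in
/-- The trace operator `H¹(Ω) → L²(∂Ω)`. It exists and is unique for bounded Lipschitz domains
(the value `0` is used for sets without a trace operator). -/
def trace (Ω : Set (E d)) : H1 Ω →L[ℝ] Lp ℝ 2 (surfaceMeasure Ω) :=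
  if h : ∃ τ, IsTraceOperator Ω τ then h.choose else 0

/-- The functions of `H¹(Ω)` whose trace vanishes on the part `Γu` of the boundary. -/
def vSubmodule (Ω Γu : Set (E d)) : Submodule ℝ (H1 Ω) where
  carrier := {v | ∀ᵐ x ∂((surfaceMeasure Ω).restrict Γu), trace Ω v x = 0}
  zero_mem' := by
    change ∀ᵐ x ∂((surfaceMeasure Ω).restrict Γu), trace Ω 0 x = 0
    rw [map_zero]
    filter_upwards [ae_restrict_of_ae (Lp.coeFn_zero ℝ 2 (surfaceMeasure Ω))] with x hx
    rw [hx]; rfl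
  add_mem' := by
    intro v w hv hw
    change ∀ᵐ x ∂((surfaceMeasure Ω).restrict Γu), trace Ω (v + w) x = 0
    rw [map_add]
    filter_upwards [hv, hw, ae_restrict_of_ae (Lp.coeFn_add (trace Ω v) (trace Ω w))]
      with x h1 h2 h3
    rw [h3, Pi.add_apply, h1, h2, add_zero]
  smul_mem' := by
    intro a v hv
    change ∀ᵐ x ∂((surfaceMeasure Ω).restrict Γu), trace Ω (a • v) x = 0
    rw [map_smul]
    filter_upwards [hv, ae_restrict_of_ae (Lp.coeFn_smul a (trace Ω v))] with x h1 h2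
    rw [h2, Pi.smul_apply, h1, smul_zero]

variable {Ω Γu : Set (E d)}

/-- The Hilbert space `𝒱` of the functions of `H¹(Ω)` that vanish on the part `Γu` of the boundary,
with the norm of `H¹(Ω)`. -/
def V (Ω Γu : Set (E d)) : Type := ↥(vSubmodule Ω Γu)

instance (Ω Γu : Set (E d)) : NormedAddCommGroup (V Ω Γu) :=
  inferInstanceAs (NormedAddCommGroup ↥(vSubmodule Ω Γu))

instance (Ω Γu : Set (E d)) : InnerProductSpace ℝ (V Ω Γu) :=
  inferInstanceAs (InnerProductSpace ℝ ↥(vSubmodule Ω Γu))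

/-- An element of `𝒱` as an element of `H¹(Ω)`. -/
def V.toH1 (v : V Ω Γu) : H1 Ω := v.1

/-- The function underlying an element of `𝒱`. -/
def V.fn (v : V Ω Γu) : L2 Ω := v.toH1.fn

/-- The gradient of an element of `𝒱`. -/
def V.grad (v : V Ω Γu) : L2Vec Ω := v.toH1.grad

/-! ### Spaces of functions of time -/

/-- The Lebesgue measure on the time interval `I = [0, T]`. -/
def timeMeasure (T : ℝ) : Measure ℝ := volume.restrict (Icc 0 T)

/-- The Bochner space `L²(I; X)`. -/
abbrev L2Time (T : ℝ) (X : Type*) [NormedAddCommGroup X] : Type _ := Lp X 2 (timeMeasure T)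

/-- The space of the functions `u ∈ L²(I; 𝒱)` such that `c ∂u/∂t ∈ L²(I; 𝒱*)`, where the duality
pairing extends the inner product of `L²(Ω)`: `c ∂u/∂t` is the derivative, in the sense of
distributions in time, of the functional `v ↦ ∫_Ω c u(t) v`. -/
structure Evolution (Ω Γu : Set (E d)) (T : ℝ) (c : E d → ℝ) where
  /-- the function `u` itself -/
  toFun : L2Time T (V Ω Γu)
  /-- the functional `c ∂u/∂t` -/
  cdt : L2Time T (StrongDual ℝ (V Ω Γu))
  weak_deriv : ∀ v : V Ω Γu, ∀ φ : ℝ → ℝ, ContDiff ℝ ∞ φ → HasCompactSupport φ →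
    tsupport φ ⊆ Ioo 0 T →
      ∫ t, deriv φ t * (∫ x in Ω, c x * (toFun t).fn x * v.fn x) ∂(timeMeasure T)
        = - ∫ t, φ t * cdt t v ∂(timeMeasure T)

variable {T : ℝ} {c : E d → ℝ}

/-- `u = 0` at the time `t₀ ∈ [0, T]`: the representative of `u` in `C([0, T]; L²(Ω))` vanishes
at `t₀`. -/
def Evolution.VanishesAt (u : Evolution Ω Γu T c) (t₀ : ℝ) : Prop :=
  ∃ w : ℝ → L2 Ω, ContinuousOn w (Icc 0 T) ∧
    (∀ᵐ t ∂(timeMeasure T), w t = (u.toFun t).fn) ∧ w t₀ = 0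

/-! ### The parabolic problem -/

/-- Conditions on the coefficients of the equation for a fixed value of the parameters: they are
measurable and essentially bounded, `c` and `k` are bounded from below by positive constants, and
`r` is nonnegative (so that `r` may vanish, as it does in pure diffusion problems). -/
structure AdmissibleCoefficients (Ω : Set (E d)) (c k r : E d → ℝ) : Prop where
  c_meas : AEMeasurable c (volume.restrict Ω)
  k_meas : AEMeasurable k (volume.restrict Ω)
  r_meas : AEMeasurable r (volume.restrict Ω)
  c_bound : ∃ c₀ c₁ : ℝ, 0 < c₀ ∧ ∀ᵐ x ∂(volume.restrict Ω), c₀ ≤ c x ∧ c x ≤ c₁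
  k_bound : ∃ k₀ k₁ : ℝ, 0 < k₀ ∧ ∀ᵐ x ∂(volume.restrict Ω), k₀ ≤ k x ∧ k x ≤ k₁
  r_bound : ∃ r₁ : ℝ, ∀ᵐ x ∂(volume.restrict Ω), 0 ≤ r x ∧ r x ≤ r₁

/-- The bilinear form `b(u, v) = ∫_I ∫_Ω (c ∂u/∂t v + k ∇u · ∇v + r u v)`. -/
def b (k r : E d → ℝ) (u : Evolution Ω Γu T c) (v : L2Time T (V Ω Γu)) : ℝ :=
  ∫ t, (u.cdt t (v t) + ∫ x in Ω, (k x * ⟪(u.toFun t).grad x, (v t).grad x⟫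
    + r x * (u.toFun t).fn x * (v t).fn x)) ∂(timeMeasure T)

/-- The load at a given time, `∫_Ω f v + ∫_{Γq} g v dS`. -/
def spaceLoad {Γq : Set (E d)} (f : L2 Ω) (g : Lp ℝ 2 ((surfaceMeasure Ω).restrict Γq))
    (v : V Ω Γu) : ℝ :=
  (∫ x in Ω, f x * v.fn x) + ∫ x, g x * trace Ω v.toH1 x ∂((surfaceMeasure Ω).restrict Γq)

/-- The linear form `l(v) = ∫_I (∫_Ω f_d v + ∫_{Γq} g_d v dS) dt`. -/
def l {Γq : Set (E d)} (f : L2Time T (L2 Ω))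
    (g : L2Time T (Lp ℝ 2 ((surfaceMeasure Ω).restrict Γq))) (v : L2Time T (V Ω Γu)) : ℝ :=
  ∫ t, spaceLoad (f t) (g t) (v t) ∂(timeMeasure T)

/-- `u` is the solution of the space-time weak formulation: `u = 0` at `t = 0` and
`b(u, v) = l(v)` for all `v ∈ L²(I; 𝒱)`. -/
def IsWeakSolution {Γq : Set (E d)} (k r : E d → ℝ) (f : L2Time T (L2 Ω))
    (g : L2Time T (Lp ℝ 2 ((surfaceMeasure Ω).restrict Γq))) (u : Evolution Ω Γu T c) : Prop :=
  u.VanishesAt 0 ∧ ∀ v : L2Time T (V Ω Γu), b k r u v = l f g v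

/-- The weak residual `R(v) = l(v) - b(u_m, v)`. -/
def R {Γq : Set (E d)} (k r : E d → ℝ) (f : L2Time T (L2 Ω))
    (g : L2Time T (Lp ℝ 2 ((surfaceMeasure Ω).restrict Γq))) (um : Evolution Ω Γu T c)
    (v : L2Time T (V Ω Γu)) : ℝ :=
  l f g v - b k r um v

/-- The output `Q(v) = ∫_I ∫_Ω (q_Σ · ∇v + f_Σ v)`. -/
def Q (qS : L2Time T (L2Vec Ω)) (fS : L2Time T (L2 Ω)) (v : L2Time T (V Ω Γu)) : ℝ :=
  ∫ t, (∫ x in Ω, (⟪qS t x, (v t).grad x⟫ + fS t x * (v t).fn x)) ∂(timeMeasure T)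

/-! ### Admissible triplets and the constitutive relation error -/

/-- `(û, q̂, ẑ)` is an admissible triplet of the primal problem: initial condition, Dirichlet
condition (contained in `𝒱`) and full equilibrium in space at almost every time. -/
structure IsPrimalAdmissible {Γq : Set (E d)} (f : L2Time T (L2 Ω))
    (g : L2Time T (Lp ℝ 2 ((surfaceMeasure Ω).restrict Γq)))
    (u : Evolution Ω Γu T c) (q : L2Time T (L2Vec Ω)) (z : L2Time T (L2 Ω)) : Prop where
  initial : u.VanishesAt 0
  equilibrium : ∀ᵐ t ∂(timeMeasure T), ∀ v : V Ω Γu,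
    u.cdt t v + ∫ x in Ω, (⟪q t x, v.grad x⟫ + z t x * v.fn x) = spaceLoad (f t) (g t) v

/-- `(û, q̂, ẑ)` is an admissible triplet of the adjoint problem, which is backward in time and
loaded by the extractors `(q_Σ, f_Σ)`. -/
structure IsAdjointAdmissible (qS : L2Time T (L2Vec Ω)) (fS : L2Time T (L2 Ω))
    (u : Evolution Ω Γu T c) (q : L2Time T (L2Vec Ω)) (z : L2Time T (L2 Ω)) : Prop where
  final : u.VanishesAt T
  equilibrium : ∀ᵐ t ∂(timeMeasure T), ∀ v : V Ω Γu,
    - u.cdt t v + ∫ x in Ω, (⟪q t x, v.grad x⟫ + z t x * v.fn x)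
      = ∫ x in Ω, (⟪qS t x, v.grad x⟫ + fS t x * v.fn x)

/-- The squared constitutive relation error in space
`e_CRE² = ∫_Ω (1/k |q̂ - k∇û|² + 1/r (ẑ - rû)²)` at a given time. -/
def creSpaceSq (k r : E d → ℝ) (u : V Ω Γu) (q : L2Vec Ω) (z : L2 Ω) : ℝ :=
  ∫ x in Ω, (1 / k x * ‖q x - k x • u.grad x‖ ^ 2 + 1 / r x * (z x - r x * u.fn x) ^ 2)

/-- The constitutive relation error `E_CRE`, with `E_CRE² = ∫_I e_CRE² dt`. -/
def cre (k r : E d → ℝ) (u : Evolution Ω Γu T c) (q : L2Time T (L2Vec Ω))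
    (z : L2Time T (L2 Ω)) : ℝ :=
  Real.sqrt (∫ t, creSpaceSq k r (u.toFun t) (q t) (z t) ∂(timeMeasure T))

/-- The constitutive relation error is finite, where a quotient `a² / r` with `r = 0` counts as `0`
if `a = 0` and as `+∞` otherwise. Only the reaction part has to be mentioned, since the diffusion
part is finite as soon as `k` is bounded from below by a positive constant; the condition always
holds when `r` is bounded from below by a positive constant, and also when `ẑ = rû`. -/
structure HasFiniteCRE (r : E d → ℝ) (u : Evolution Ω Γu T c) (z : L2Time T (L2 Ω)) : Prop where
  zero_of_zero : ∀ᵐ t ∂(timeMeasure T), ∀ᵐ x ∂(volume.restrict Ω), r x = 0 → z t x = 0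
  integrable_space : ∀ᵐ t ∂(timeMeasure T),
    Integrable (fun x => 1 / r x * (z t x - r x * (u.toFun t).fn x) ^ 2) (volume.restrict Ω)
  integrable_time : Integrable
    (fun t => ∫ x in Ω, 1 / r x * (z t x - r x * (u.toFun t).fn x) ^ 2) (timeMeasure T)

/-- The correction term
`Q_corr = ∫_I ∫_Ω (1/k (q̂_m - k∇u_m) · q̃* + 1/r (ẑ_m - r u_m) z̃*)`, where
`(q̃*, z̃*) = 1/2 [(q̃, z̃) + (k∇ũ, rũ)]` is the averaged adjoint flux pair. -/
def Qcorr (k r : E d → ℝ) (u : Evolution Ω Γu T c) (q : L2Time T (L2Vec Ω)) (z : L2Time T (L2 Ω))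
    (ua : Evolution Ω Γu T c) (qa : L2Time T (L2Vec Ω)) (za : L2Time T (L2 Ω)) : ℝ :=
  ∫ t, (∫ x in Ω,
    (1 / k x * ⟪q t x - k x • (u.toFun t).grad x,
        (1 / 2 : ℝ) • (qa t x + k x • (ua.toFun t).grad x)⟫
      + 1 / r x * (z t x - r x * (u.toFun t).fn x)
        * (1 / 2 * (za t x + r x * (ua.toFun t).fn x)))) ∂(timeMeasure T)

/-- The difference of the two forms of the correction term,
`∫_I ∫_Ω (1/k (q̃ - k∇ũ) · (q̂* - k∇u_m) + 1/r (z̃ - rũ) (ẑ* - r u_m))`, where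
`(q̂*, ẑ*) = 1/2 [(q̂_m, ẑ_m) + (k∇u_m, r u_m)]` is the averaged primal flux pair. -/
def corrShift (k r : E d → ℝ) (u : Evolution Ω Γu T c) (q : L2Time T (L2Vec Ω))
    (z : L2Time T (L2 Ω)) (ua : Evolution Ω Γu T c) (qa : L2Time T (L2Vec Ω))
    (za : L2Time T (L2 Ω)) : ℝ :=
  ∫ t, (∫ x in Ω,
    (1 / k x * ⟪qa t x - k x • (ua.toFun t).grad x,
        (1 / 2 : ℝ) • (q t x + k x • (u.toFun t).grad x) - k x • (u.toFun t).grad x⟫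
      + 1 / r x * (za t x - r x * (ua.toFun t).fn x)
        * (1 / 2 * (z t x + r x * (u.toFun t).fn x) - r x * (u.toFun t).fn x))) ∂(timeMeasure T)

end ParabolicCRE

end

open ParabolicCRE

noncomputable section

/-! Everything is Euclidean geometry for the form ⟨(X, x), (Y, y)⟩ = ∫_I ∫_Ω (1/k X · Y + 1/r x y).
Let e = u - u_m, let G = (k∇e, re), and let A and B be the adjoint gap (q̃ - k∇ũ, z̃ - rũ) and the
primal gap (q̂_m - k∇u_m, ẑ_m - r u_m). Then ‖A‖ and ‖B‖ are the two constitutive relation errors.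

Adjoint equilibrium tested with e, combined with integration by parts in time, gives ΔQ - R(ũ) = ⟨A,
G⟩ (`Q_sub_Q_sub_R_eq`). Primal equilibrium tested with e gives ∫ ⟨c ∂e/∂t, e⟩ + ⟨G, G⟩ = ⟨B, G⟩.
The first term is nonnegative because e vanishes at time 0, hence ⟨G, G⟩ ≤ ⟨B, G⟩
(`integral_energy_error_le`). So G lies in the ball with B as a diameter: ‖G‖ ≤ ‖B‖ and ‖G - B/2‖ ≤
‖B‖/2. Cauchy–Schwarz against A yields both bounds (`abs_le_of_form_nonneg`), because Q_corr = R(ũ)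
+ ⟨A, B⟩/2 (`Qcorr_eq_R_add_corrShift`).

Two points need care. The time derivative is only a functional on 𝒱, so integration by parts and
positivity are obtained from Steklov averages: the difference quotients of the mass form are
compared after a translation in time, and the step tends to 0. Moreover 1/r may be unbounded or
meaningless; finiteness of the errors makes the gaps vanish where r does, while the weight cancels
in every pairing with G, since 1/r (x · re) = xe. -/

namespace ParabolicCRE

/-! ### Steklov averages and integration by parts in time -/

section Time

open Filter DomAddAct

variable {V : Type*} [NormedAddCommGroup V] [NormedSpace ℝ V]

/-- The duality pairing of an `L²` function with values in the dual space and an `L²` function is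
integrable. -/
theorem integrable_dual_apply {α : Type*} [MeasurableSpace α] {μ : Measure α}
    {f : α → StrongDual ℝ V} {v : α → V} (hf : MemLp f 2 μ) (hv : MemLp v 2 μ) :
    Integrable (fun t => f t (v t)) μ :=
  memLp_one_iff_integrable.1
    ((ContinuousLinearMap.id ℝ (StrongDual ℝ V)).memLp_of_bilin (r := 1) hf hv)

/-- A bounded bilinear form of two `L²` functions is integrable. -/
theorem integrable_bilin {α X Y : Type*} [MeasurableSpace α] {μ : Measure α}
    [NormedAddCommGroup X] [NormedSpace ℝ X] [NormedAddCommGroup Y] [NormedSpace ℝ Y]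
    (C : X →L[ℝ] Y →L[ℝ] ℝ) {u : α → X} {v : α → Y} (hu : MemLp u 2 μ) (hv : MemLp v 2 μ) :
    Integrable (fun t => C (u t) (v t)) μ :=
  memLp_one_iff_integrable.1 (C.memLp_of_bilin (r := 1) hu hv)

/-- Translations act continuously on L² because the exponent is finite, and pairing with the fixed
function `v` is continuous on L². -/
theorem continuous_integral_translate {f : ℝ → StrongDual ℝ V} {v : ℝ → V}
    (hf : MemLp f 2 volume) (hv : MemLp v 2 volume) :
    Continuous (fun σ : ℝ => ∫ t, f (t - σ) (v t)) := by
  let F : Lp (StrongDual ℝ V) 2 (volume : Measure ℝ) := hf.toLp f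
  let W : Lp V 2 (volume : Measure ℝ) := hv.toLp v
  have hF : Fact ((2 : ℝ≥0∞) ≠ ⊤) := ⟨by simp⟩
  have h1 : Continuous (fun σ : ℝ => (mk (-σ) +ᵥ F : Lp (StrongDual ℝ V) 2 (volume : Measure ℝ))) :=
    (continuous_mk.comp continuous_neg).vadd continuous_const
  have h2 : Continuous (fun σ : ℝ =>
      (ContinuousLinearMap.id ℝ (StrongDual ℝ V)).lpPairing volume 2 2 (mk (-σ) +ᵥ F) W) :=
    ((ContinuousLinearMap.continuous _).comp h1).clm_apply continuous_const
  convert h2 using 2 with σ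
  rw [ContinuousLinearMap.lpPairing_eq_integral]
  refine integral_congr_ae ?_
  have h3 := vadd_Lp_ae_eq (mk (-σ)) F
  have h4 : ∀ᵐ t : ℝ, F (-σ + t) = f (-σ + t) :=
    (quasiMeasurePreserving_add_left volume (-σ)).ae hf.coeFn_toLp
  filter_upwards [h3, h4, hv.coeFn_toLp] with t h3 h4 h5
  have : (mk.symm (mk (-σ)) +ᵥ t : ℝ) = -σ + t := rfl
  rw [ContinuousLinearMap.id_apply, h3, this, h4, h5, neg_add_eq_sub]

/-- This is the integrand of the convolution of `v` with the reflection of `f`. It justifies Fubini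
for Steklov averages. -/
theorem integrable_translate_prod {f : ℝ → StrongDual ℝ V} {v : ℝ → V}
    (hf : Integrable f) (hv : Integrable v) :
    Integrable (fun p : ℝ × ℝ => f (p.2 - p.1) (v p.2)) := by
  have h := hv.convolution_integrand (ContinuousLinearMap.id ℝ (StrongDual ℝ V)).flip hf.comp_neg
  refine h.congr (Eventually.of_forall fun p => ?_)
  simp [neg_sub]

/-- The Steklov averages of `f ∈ L²` converge to `f`, tested with a function `v ∈ L²`. -/
theorem hasDerivAt_steklov {f : ℝ → StrongDual ℝ V} {v : ℝ → V}
    (hf : MemLp f 2 volume) (hv : MemLp v 2 volume) (hf1 : Integrable f) (hv1 : Integrable v) :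
    HasDerivAt (fun h : ℝ => ∫ t, (∫ s in (t - h)..t, f s) (v t)) (∫ t, f t (v t)) 0 := by
  have hc := continuous_integral_translate hf hv
  -- Since the average over [t - h, t] is the integral of f(t - σ) over σ from 0 to h, exchanging
  -- the integrals turns the pairing into a primitive of a continuous function of σ.
  have h1 : HasDerivAt (fun h : ℝ => ∫ σ in (0 : ℝ)..h, ∫ t, f (t - σ) (v t))
      (∫ t, f (t - 0) (v t)) 0 :=
    intervalIntegral.integral_hasDerivAt_right (by simp) (hc.stronglyMeasurableAtFilter _ _)
      hc.continuousAt
  simp only [sub_zero] at h1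
  convert h1 using 2 with h
  rw [intervalIntegral_integral_swap]
  · refine integral_congr_ae (Eventually.of_forall fun t => ?_)
    have hi : IntervalIntegrable f volume (t - h) t := hf1.intervalIntegrable
    have hi2 : IntervalIntegrable (fun σ => f (t - σ)) volume 0 h :=
      (hf1.comp_sub_left t).intervalIntegrable
    have e := intervalIntegral.integral_comp_sub_left f t (a := 0) (b := h)
    rw [sub_zero] at e
    simp only
    rw [← e, ContinuousLinearMap.intervalIntegral_apply hi2]
  · refine (integrable_translate_prod hf1 hv1).mono_measure ?_
    rw [Measure.volume_eq_prod]
    exact Measure.prod_mono Measure.restrict_le_self le_rfl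

variable {T : ℝ} (C : V →L[ℝ] V →L[ℝ] ℝ)

/-- Only t in [0, T] contributes, as `v` vanishes elsewhere. For such t and h ≥ 0 both t and t - h
are at most T, which is where C u is known to be a primitive of `f`; t - h may be negative. -/
theorem integral_steklov_forward {u v : ℝ → V} {f : ℝ → StrongDual ℝ V}
    (hu : MemLp u 2 volume) (hv : MemLp v 2 volume) (hf : Integrable f)
    (hvT : ∀ t, t ∉ Icc 0 T → v t = 0)
    (huf : ∀ᵐ t, t ≤ T → C (u t) = ∫ s in (0 : ℝ)..t, f s) {h : ℝ} (hh : 0 ≤ h) :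
    ∫ t, (∫ s in (t - h)..t, f s) (v t) = (∫ t, C (u t) (v t)) - ∫ t, C (u (t - h)) (v t) := by
  have hu' : MemLp (fun t => u (t - h)) 2 volume :=
    hu.comp_measurePreserving (measurePreserving_sub_right volume h)
  rw [← integral_sub (integrable_bilin C hu hv) (integrable_bilin C hu' hv)]
  refine integral_congr_ae ?_
  have huf' : ∀ᵐ t, t - h ≤ T → C (u (t - h)) = ∫ s in (0 : ℝ)..(t - h), f s :=
    (measurePreserving_sub_right volume h).quasiMeasurePreserving.ae huf
  filter_upwards [huf, huf'] with t h1 h2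
  by_cases ht : t ∈ Icc 0 T
  · rw [h1 ht.2, h2 (by linarith [ht.2]), ← sub_apply,
      intervalIntegral.integral_interval_sub_left hf.intervalIntegrable hf.intervalIntegrable]
  · simp [hvT t ht]

/-- Mirror image of the forward case: the step is -h, and t + h may exceed T, where the primitive
from T still describes C u. -/
theorem integral_steklov_backward {u v : ℝ → V} {f : ℝ → StrongDual ℝ V}
    (hu : MemLp u 2 volume) (hv : MemLp v 2 volume) (hf : Integrable f)
    (hvT : ∀ t, t ∉ Icc 0 T → v t = 0)
    (huf : ∀ᵐ t, 0 ≤ t → C (u t) = ∫ s in T..t, f s) {h : ℝ} (hh : 0 ≤ h) :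
    ∫ t, (∫ s in (t - -h)..t, f s) (v t) = (∫ t, C (u t) (v t)) - ∫ t, C (u (t + h)) (v t) := by
  have hu' : MemLp (fun t => u (t + h)) 2 volume :=
    hu.comp_measurePreserving (measurePreserving_add_right volume h)
  rw [← integral_sub (integrable_bilin C hu hv) (integrable_bilin C hu' hv)]
  refine integral_congr_ae ?_
  have huf' : ∀ᵐ t, 0 ≤ t + h → C (u (t + h)) = ∫ s in T..(t + h), f s :=
    (measurePreserving_add_right volume h).quasiMeasurePreserving.ae huf
  filter_upwards [huf, huf'] with t h1 h2
  by_cases ht : t ∈ Icc 0 T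
  · rw [h1 ht.1, h2 (by linarith [ht.1]), ← sub_apply, sub_neg_eq_add,
      intervalIntegral.integral_interval_sub_left hf.intervalIntegrable hf.intervalIntegrable]
  · simp [hvT t ht]

/-- Integration by parts in time: if `C u` has the derivative `f` and vanishes at `0`, and `C a` has
the derivative `g` and vanishes at `T`, then `∫ ⟨f, a⟩ + ∫ ⟨g, u⟩ = 0`. -/
theorem integral_dual_add_integral_dual_eq_zero (hC : ∀ x y, C x y = C y x)
    {u a : ℝ → V} {f g : ℝ → StrongDual ℝ V}
    (hu : MemLp u 2 volume) (ha : MemLp a 2 volume)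
    (hf : MemLp f 2 volume) (hg : MemLp g 2 volume)
    (hu1 : Integrable u) (ha1 : Integrable a) (hf1 : Integrable f) (hg1 : Integrable g)
    (huT : ∀ t, t ∉ Icc 0 T → u t = 0) (haT : ∀ t, t ∉ Icc 0 T → a t = 0)
    (huf : ∀ᵐ t, t ≤ T → C (u t) = ∫ s in (0 : ℝ)..t, f s)
    (hag : ∀ᵐ t, 0 ≤ t → C (a t) = ∫ s in T..t, g s) :
    (∫ t, f t (a t)) + ∫ t, g t (u t) = 0 := by
  -- The two averages agree only for steps h ≥ 0, so one-sided derivatives at 0 are compared. The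
  -- backward average is taken at -h, which produces the minus sign.
  have d1 := (hasDerivAt_steklov hf ha hf1 ha1).hasDerivWithinAt (s := Ici 0)
  have d2' := hasDerivAt_steklov hg hu hg1 hu1
  rw [← neg_zero] at d2'
  have d2 := (d2'.scomp_of_eq (0 : ℝ) (hasDerivAt_neg 0) rfl).hasDerivWithinAt (s := Ici 0)
  have e : ∀ h ∈ Ici (0 : ℝ), (∫ t, (∫ s in (t - h)..t, f s) (a t))
      = ∫ t, (∫ s in (t - -h)..t, g s) (u t) := by
    intro h hh
    rw [integral_steklov_forward C hu ha hf1 haT huf hh,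
      integral_steklov_backward C ha hu hg1 huT hag hh]
    congr 1
    · simp only [hC]
    -- Shifting time by h moves the translation from one factor to the other; the symmetry of `C`
    -- does the rest.
    · rw [← integral_add_right_eq_self (fun t => C (u (t - h)) (a t)) h]
      simp only [add_sub_cancel_right, hC]
  have d3 := d2.congr e (e 0 self_mem_Ici)
  have := (uniqueDiffWithinAt_Ici (0 : ℝ)).eq_deriv _ d1 d3
  rw [this]
  simp

/-- If `C u` has the derivative `f` and vanishes at `0`, then `∫ ⟨f, u⟩ ≥ 0`. -/
theorem integral_dual_self_nonneg (hC : ∀ x y, C x y = C y x) (hpos : ∀ x, 0 ≤ C x x)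
    {u : ℝ → V} {f : ℝ → StrongDual ℝ V}
    (hu : MemLp u 2 volume) (hf : MemLp f 2 volume)
    (hu1 : Integrable u) (hf1 : Integrable f)
    (huT : ∀ t, t ∉ Icc 0 T → u t = 0)
    (huf : ∀ᵐ t, t ≤ T → C (u t) = ∫ s in (0 : ℝ)..t, f s) :
    0 ≤ ∫ t, f t (u t) := by
  have d1 := (hasDerivAt_steklov hf hu hf1 hu1).hasDerivWithinAt (s := Ioi 0)
  rw [hasDerivWithinAt_iff_tendsto_slope' self_notMem_Ioi] at d1
  refine ge_of_tendsto d1 ?_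
  filter_upwards [self_mem_nhdsWithin] with h hh
  have hh' : 0 < h := hh
  have hu' : MemLp (fun t => u (t - h)) 2 volume :=
    hu.comp_measurePreserving (measurePreserving_sub_right volume h)
  have e0 : ∫ t, C (u (t - h)) (u (t - h)) = ∫ t, C (u t) (u t) :=
    integral_sub_right_eq_self (fun t => C (u t) (u t)) h
  have i1 := integrable_bilin C hu hu
  have i2 := integrable_bilin C hu' hu
  have i3 := integrable_bilin C hu' hu'
  -- Integrate C(u(t) - u(t - h), u(t) - u(t - h)) ≥ 0. By translation invariance the two squares
  -- have equal integrals, so the sum is twice the numerator of the difference quotient.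
  have key : 0 ≤ ∫ t, ((C (u t) (u t) - 2 * C (u (t - h)) (u t)) + C (u (t - h)) (u (t - h))) := by
    refine integral_nonneg fun t => ?_
    have := hpos (u t - u (t - h))
    simp only [map_sub, sub_apply, hC (u t) (u (t - h))] at this
    simp only [Pi.zero_apply]
    linarith
  rw [integral_add (by exact i1.sub (i2.const_mul 2)) i3, integral_sub i1 (i2.const_mul 2),
    integral_const_mul, e0] at key
  simp only [slope, vsub_eq_sub, sub_zero, smul_eq_mul]
  rw [integral_steklov_forward C hu hu hf1 huT huf hh'.le]
  simp only [intervalIntegral.integral_same, zero_apply, integral_zero,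
    sub_zero]
  exact mul_nonneg (inv_nonneg.2 hh'.le) (by linarith)

end Time

/-! ### Weak derivatives on a time interval -/

/-- A smooth function with compact support in `(0, T)` and mean zero is the derivative of a smooth
function with compact support in `(0, T)`. -/
theorem exists_primitive_testFunction {T : ℝ} {ψ : ℝ → ℝ} (hψ : ContDiff ℝ ∞ ψ)
    (hc : HasCompactSupport ψ) (hs : tsupport ψ ⊆ Ioo 0 T) (h0 : ∫ t, ψ t = 0) :
    ∃ φ : ℝ → ℝ, ContDiff ℝ ∞ φ ∧ HasCompactSupport φ ∧ tsupport φ ⊆ Ioo 0 T ∧ deriv φ = ψ := by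
  have hd : ∀ t, HasDerivAt (fun x => ∫ s in (0 : ℝ)..x, ψ s) (ψ t) t := fun t =>
    intervalIntegral.integral_hasDerivAt_right (hψ.continuous.intervalIntegrable _ _)
      (hψ.continuous.stronglyMeasurableAtFilter _ _) hψ.continuous.continuousAt
  have hdφ : deriv (fun x => ∫ s in (0 : ℝ)..x, ψ s) = ψ := funext fun t => (hd t).deriv
  have hsub : ∃ a b, 0 < a ∧ b < T ∧ tsupport ψ ⊆ Icc a b := by
    have hK : IsCompact (tsupport ψ) := hc
    rcases (tsupport ψ).eq_empty_or_nonempty with h | h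
    -- For empty support any bounds with 0 < a and b < T serve, even if [a, b] is empty.
    · exact ⟨1, T - 1, by norm_num, by linarith, by simp [h]⟩
    · obtain ⟨a, ha, ha'⟩ := hK.exists_isLeast h
      obtain ⟨b, hb, hb'⟩ := hK.exists_isGreatest h
      exact ⟨a, b, (hs ha).1, (hs hb).2, fun x hx => ⟨ha' hx, hb' hx⟩⟩
  obtain ⟨a, b, ha, hb, hab⟩ := hsub
  have hz : ∀ t, t ∉ Icc a b → ψ t = 0 := fun t ht =>
    image_eq_zero_of_notMem_tsupport fun h => ht (hab h)
  have hsupp : Function.support (fun x => ∫ s in (0 : ℝ)..x, ψ s) ⊆ Icc a b := by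
    intro x hx
    by_contra hxab
    apply hx
    rcases lt_or_ge x a with h | h
    · refine intervalIntegral.integral_zero_ae (Filter.Eventually.of_forall fun t ht => hz t ?_)
      intro h'
      have := (mem_uIoc.1 ht)
      rcases this with h1 | h1 <;> linarith [h1.1, h1.2, h'.1]
    · have h2 : b < x := by
        by_contra h3
        exact hxab ⟨h, not_lt.1 h3⟩
      have hx0 : 0 ≤ x := by linarith
      change ∫ s in (0 : ℝ)..x, ψ s = 0
      rw [intervalIntegral.integral_of_le hx0, setIntegral_eq_integral_of_forall_compl_eq_zero, h0]
      intro t ht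
      refine hz t fun h' => ht ⟨by linarith [h'.1], by linarith [h'.2]⟩
  have htsupp : tsupport (fun x => ∫ s in (0 : ℝ)..x, ψ s) ⊆ Icc a b :=
    closure_minimal hsupp isClosed_Icc
  refine ⟨fun x => ∫ s in (0 : ℝ)..x, ψ s, ?_, ?_, ?_, hdφ⟩
  · rw [contDiff_infty_iff_deriv]
    exact ⟨fun t => (hd t).differentiableAt, by rwa [hdφ]⟩
  · exact isCompact_Icc.of_isClosed_subset (isClosed_tsupport _) htsupp
  · exact htsupp.trans fun x hx => ⟨ha.trans_le hx.1, hx.2.trans_lt hb⟩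

/-- A continuous function on `[0, T]` whose integral against every smooth function of mean zero
with compact support in `(0, T)` vanishes is constant. -/
theorem eqOn_const_of_integral_testFunction_eq_zero {T : ℝ} (hT : 0 < T) {H : ℝ → ℝ}
    (hH : ContinuousOn H (Icc 0 T))
    (h : ∀ ψ : ℝ → ℝ, ContDiff ℝ ∞ ψ → HasCompactSupport ψ → tsupport ψ ⊆ Ioo 0 T →
      ∫ t, ψ t = 0 → ∫ t in Icc 0 T, ψ t * H t = 0) :
    ∃ K, ∀ t ∈ Icc 0 T, H t = K := by
  -- A bump of integral one supported in [T/4, 3T/4]. Subtracting (∫ ψ) η from a test function ψ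
  -- makes its mean zero, so the constant must be the η-average of `H`.
  let B : ContDiffBump (T / 2) := ⟨T / 8, T / 4, by linarith, by linarith⟩
  let η : ℝ → ℝ := B.normed volume
  have hη : ContDiff ℝ ∞ η := B.contDiff_normed
  have hηc : HasCompactSupport η := B.hasCompactSupport_normed
  have hηs : tsupport η ⊆ Ioo 0 T := by
    rw [B.tsupport_normed_eq, Real.closedBall_eq_Icc]
    intro x hx
    have h1 : T / 2 - T / 4 ≤ x := hx.1
    have h2 : x ≤ T / 2 + T / 4 := hx.2
    constructor <;> linarith
  have hη1 : ∫ t, η t = 1 := B.integral_normed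
  have hHi : IntegrableOn H (Icc 0 T) := hH.integrableOn_Icc
  have hint : ∀ ψ : ℝ → ℝ, Continuous ψ → IntegrableOn (fun t => ψ t * H t) (Icc 0 T) :=
    fun ψ hψ => (hψ.continuousOn.mul hH).integrableOn_Icc
  set K : ℝ := ∫ t in Icc 0 T, η t * H t with hK
  refine ⟨K, ?_⟩
  have hae : ∀ᵐ t ∂(volume.restrict (Icc 0 T)), t ∈ Ioo 0 T → H t - K = 0 := by
    refine isOpen_Ioo.ae_eq_zero_of_integral_contDiff_smul_eq_zero ?_ ?_
    · have : Integrable (fun t => H t - K) (volume.restrict (Icc 0 T)) :=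
        hHi.sub (integrable_const K)
      exact this.locallyIntegrable.locallyIntegrableOn _
    · intro ψ hψ hψc hψs
      have hψi : Integrable ψ := hψ.continuous.integrable_of_hasCompactSupport hψc
      have hηi : Integrable η := hη.continuous.integrable_of_hasCompactSupport hηc
      have hψI : ∫ t in Icc 0 T, ψ t = ∫ t, ψ t :=
        setIntegral_eq_integral_of_forall_compl_eq_zero fun t ht =>
          image_eq_zero_of_notMem_tsupport fun h' => ht (Ioo_subset_Icc_self (hψs h'))
      have key := h (fun t => ψ t - (∫ s, ψ s) * η t) (hψ.sub (contDiff_const.mul hη))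
        (hψc.sub hηc.mul_left) ?_ ?_
      · simp only [sub_mul, mul_assoc] at key
        rw [integral_sub (hint ψ hψ.continuous) ((hint η hη.continuous).const_mul _),
          integral_const_mul, ← hK] at key
        simp only [smul_eq_mul, mul_sub]
        rw [integral_sub (hint ψ hψ.continuous) (hψi.integrableOn.mul_const K), integral_mul_const,
          hψI]
        exact key
      · refine (tsupport_sub _ _).trans (union_subset hψs ?_)
        exact (tsupport_mul_subset_right).trans hηs
      · rw [integral_sub hψi (hηi.const_mul _), integral_const_mul, hη1, mul_one, sub_self]
  have hae' : H =ᵐ[volume.restrict (Icc 0 T)] fun _ => K := by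
    have h1 : ∀ᵐ t ∂(volume.restrict (Icc 0 T)), t ∈ Ioo 0 T := by
      rw [← restrict_Ioo_eq_restrict_Icc]
      exact ae_restrict_mem measurableSet_Ioo
    filter_upwards [hae, h1] with t h1 h2
    linarith [h1 h2]
  exact Measure.eqOn_Icc_of_ae_eq volume hT.ne hae' hH continuousOn_const

/-- A continuous function on `[0, T]` with a weak derivative `g ∈ L¹` is a primitive of `g`. -/
theorem eq_add_integral_of_weak_deriv {T : ℝ} (hT : 0 < T) {F g : ℝ → ℝ}
    (hF : ContinuousOn F (Icc 0 T)) (hg : Integrable g (timeMeasure T))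
    (h : ∀ φ : ℝ → ℝ, ContDiff ℝ ∞ φ → HasCompactSupport φ → tsupport φ ⊆ Ioo 0 T →
      ∫ t, deriv φ t * F t ∂(timeMeasure T) = - ∫ t, φ t * g t ∂(timeMeasure T))
    {t : ℝ} (ht : t ∈ Icc 0 T) : F t = F 0 + ∫ s in (0 : ℝ)..t, g s := by
  have hgi : IntervalIntegrable g volume 0 T :=
    (intervalIntegrable_iff_integrableOn_Icc_of_le hT.le).2 hg
  have hu : uIcc (0 : ℝ) T = Icc 0 T := uIcc_of_le hT.le
  have hGac := hgi.absolutelyContinuousOnInterval_intervalIntegral (c := 0) (by simp)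
  have hGc : ContinuousOn (fun x => ∫ s in (0 : ℝ)..x, g s) (Icc 0 T) := by
    simpa [hu] using hGac.continuousOn
  -- A mean-zero test function is φ' for a test function φ. Parts against the absolutely continuous
  -- primitive of `g` show that it has the same weak derivative as `F`, so their difference is
  -- constant.
  obtain ⟨K, hK⟩ := eqOn_const_of_integral_testFunction_eq_zero hT (hF.sub hGc) (by
    intro ψ hψ hψc hψs hψ0
    obtain ⟨φ, hφ, hφc, hφs, rfl⟩ := exists_primitive_testFunction hψ hψc hψs hψ0
    have hφac : AbsolutelyContinuousOnInterval φ 0 T :=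
      ((hφ.of_le (by simp)).contDiffOn).absolutelyContinuousOnInterval
    have hparts := hφac.integral_mul_deriv_eq_deriv_mul hGac
    have hφ0 : φ 0 = 0 := image_eq_zero_of_notMem_tsupport fun h' => lt_irrefl _ (hφs h').1
    have hφT : φ T = 0 := image_eq_zero_of_notMem_tsupport fun h' => lt_irrefl _ (hφs h').2
    have e1 : ∫ x in (0 : ℝ)..T, φ x * deriv (fun y => ∫ s in (0 : ℝ)..y, g s) x
        = ∫ x in (0 : ℝ)..T, φ x * g x := by
      refine intervalIntegral.integral_congr_ae ?_
      filter_upwards [hgi.ae_hasDerivAt_integral] with x hx hx'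
      rw [(hx (uIoc_subset_uIcc hx') 0 (by simp)).deriv]
    rw [e1, hφ0, hφT, zero_mul, zero_mul, sub_zero, zero_sub,
      intervalIntegral.integral_of_le hT.le, intervalIntegral.integral_of_le hT.le,
      ← integral_Icc_eq_integral_Ioc, ← integral_Icc_eq_integral_Ioc] at hparts
    have h1 := h φ hφ hφc hφs
    have i1 : IntegrableOn (fun x => deriv φ x * F x) (Icc 0 T) :=
      (hψ.continuous.continuousOn.mul hF).integrableOn_Icc
    have i2 : IntegrableOn (fun x => deriv φ x * ∫ s in (0 : ℝ)..x, g s) (Icc 0 T) :=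
      (hψ.continuous.continuousOn.mul hGc).integrableOn_Icc
    simp only [Pi.sub_apply, mul_sub]
    rw [integral_sub i1 i2]
    change (∫ x, deriv φ x * F x ∂(timeMeasure T)) - _ = 0
    rw [h1]
    change -(∫ x in Icc 0 T, φ x * g x) - _ = 0
    rw [hparts]
    ring)
  have k0 := hK 0 ⟨le_rfl, hT.le⟩
  have kt := hK t ht
  simp only [Pi.sub_apply, intervalIntegral.integral_same, sub_zero] at k0 kt
  linarith

/-! ### Weighted inner products in L² -/

section Weight

variable {α : Type*} [MeasurableSpace α] {μ : Measure α} {F : Type*} [NormedAddCommGroup F]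
  [InnerProductSpace ℝ F] {m : α → ℝ}

/-- Multiplication by an essentially bounded function in `L²`. -/
def mulL (F : Type*) [NormedAddCommGroup F] [InnerProductSpace ℝ F] (hm : MemLp m ∞ μ) :
    Lp F 2 μ →L[ℝ] Lp F 2 μ :=
  (ContinuousLinearMap.lsmul ℝ ℝ).holderL μ ∞ 2 2 (hm.toLp m)

theorem coeFn_mulL (hm : MemLp m ∞ μ) (a : Lp F 2 μ) : mulL F hm a =ᵐ[μ] fun x => m x • a x := by
  have h1 := (ContinuousLinearMap.lsmul ℝ ℝ).coeFn_holder (r := 2) (hm.toLp m) a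
  filter_upwards [h1, hm.coeFn_toLp] with x h1 h2
  rw [mulL, ContinuousLinearMap.holderL_apply_apply, h1, h2, ContinuousLinearMap.lsmul_apply]

/-- The weighted inner product `(a, b) ↦ ∫ m ⟪a, b⟫` for a bounded weight `m`. -/
def weightedInner (F : Type*) [NormedAddCommGroup F] [InnerProductSpace ℝ F] (hm : MemLp m ∞ μ) :
    Lp F 2 μ →L[ℝ] Lp F 2 μ →L[ℝ] ℝ :=
  (innerSL ℝ).comp (mulL F hm)

theorem integral_weight_inner (hm : MemLp m ∞ μ) (a b : Lp F 2 μ) :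
    ∫ x, m x * ⟪a x, b x⟫ ∂μ = weightedInner F hm a b := by
  change _ = ⟪mulL F hm a, b⟫
  rw [L2.inner_def]
  refine integral_congr_ae ?_
  filter_upwards [coeFn_mulL hm a] with x hx
  rw [hx, real_inner_smul_left]

theorem integrable_weight_inner (hm : MemLp m ∞ μ) (a b : Lp F 2 μ) :
    Integrable (fun x => m x * ⟪a x, b x⟫) μ := by
  refine (L2.integrable_inner (𝕜 := ℝ) (mulL F hm a) b).congr ?_
  filter_upwards [coeFn_mulL hm a] with x hx
  rw [hx, real_inner_smul_left]

theorem mulL_inner_comm (hm : MemLp m ∞ μ) (a b : Lp F 2 μ) :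
    ⟪mulL F hm a, b⟫ = ⟪mulL F hm b, a⟫ := by
  change weightedInner F hm a b = weightedInner F hm b a
  rw [← integral_weight_inner, ← integral_weight_inner]
  simp only [real_inner_comm]

theorem L2_inner_real (a b : Lp ℝ 2 μ) : ⟪a, b⟫ = ∫ x, a x * b x ∂μ := by
  rw [L2.inner_def]
  refine integral_congr_ae (Filter.Eventually.of_forall fun x => ?_)
  simp [mul_comm]

theorem integrable_mul_L2 (a b : Lp ℝ 2 μ) : Integrable (fun x => a x * b x) μ :=
  (Lp.memLp a).integrable_mul (q := 2) (Lp.memLp b)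

/-- Measurability in time of a weighted inner product whose weight may be unbounded. -/
theorem aestronglyMeasurable_integral_weight {β : Type*} [MeasurableSpace β] {ν : Measure β}
    (hm : AEStronglyMeasurable m μ) (hm0 : ∀ᵐ x ∂μ, 0 ≤ m x) {a b : β → Lp ℝ 2 μ}
    (ha : AEStronglyMeasurable a ν) (hb : AEStronglyMeasurable b ν)
    (hab : ∀ᵐ t ∂ν, Integrable (fun x => m x * (a t x * b t x)) μ) :
    AEStronglyMeasurable (fun t => ∫ x, m x * (a t x * b t x) ∂μ) ν := by
  -- Truncated at n, the weight gives a continuous bilinear form on L², hence a measurable function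
  -- of time. The truncated integrals converge by domination with the full integrand.
  have hmn : ∀ n : ℕ, MemLp (fun x => min (m x) n) ∞ μ := fun n =>
    memLp_top_of_bound (hm.inf aestronglyMeasurable_const) n (by
      filter_upwards [hm0] with x hx
      rw [Real.norm_eq_abs, abs_of_nonneg (le_min hx (Nat.cast_nonneg n))]
      exact min_le_right _ _)
  refine aestronglyMeasurable_of_tendsto_ae Filter.atTop
    (f := fun (n : ℕ) t => weightedInner ℝ (hmn n) (a t) (b t)) (fun n => ?_) ?_
  · exact (weightedInner ℝ (hmn n)).aestronglyMeasurable_comp₂ ha hb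
  · filter_upwards [hab] with t ht
    simp only [← integral_weight_inner]
    refine tendsto_integral_of_dominated_convergence (fun x => ‖m x * (a t x * b t x)‖)
      (fun n => (integrable_weight_inner (hmn n) _ _).aestronglyMeasurable) ht.norm
      (fun n => ?_) ?_
    · filter_upwards [hm0] with x hx
      have e : ⟪a t x, b t x⟫ = a t x * b t x := by simp [mul_comm]
      rw [e, norm_mul, norm_mul (m x), Real.norm_eq_abs, Real.norm_eq_abs (m x), abs_of_nonneg hx,
        abs_of_nonneg (le_min hx (Nat.cast_nonneg n))]
      gcongr
      exact min_le_left _ _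
    · refine Filter.Eventually.of_forall fun x => ?_
      have e : ⟪a t x, b t x⟫ = a t x * b t x := by simp [mul_comm]
      rw [e]
      refine tendsto_const_nhds.congr' ?_
      obtain ⟨N, hN⟩ := exists_nat_ge (m x)
      filter_upwards [Filter.eventually_ge_atTop N] with n hn
      rw [min_eq_left (hN.trans (by exact_mod_cast hn))]

end Weight

/-! ### The mass form and the time derivative of functions in the evolution space -/

variable {d : ℕ} {Ω Γu : Set (E d)} {T : ℝ} {c k r : E d → ℝ}

/-- The map `v ↦ v` from `𝒱` to `L²(Ω)`. -/
def V.fnL (Ω Γu : Set (E d)) : V Ω Γu →L[ℝ] L2 Ω :=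
  (WithLp.fstL 2 ℝ (L2 Ω) (L2Vec Ω)).comp
    ((h1Submodule Ω).subtypeL.comp (vSubmodule Ω Γu).subtypeL)

/-- The map `v ↦ ∇v` from `𝒱` to `L²(Ω)^d`. -/
def V.gradL (Ω Γu : Set (E d)) : V Ω Γu →L[ℝ] L2Vec Ω :=
  (WithLp.sndL 2 ℝ (L2 Ω) (L2Vec Ω)).comp
    ((h1Submodule Ω).subtypeL.comp (vSubmodule Ω Γu).subtypeL)

theorem V.fnL_apply (v : V Ω Γu) : V.fnL Ω Γu v = v.fn := rfl

theorem V.gradL_apply (v : V Ω Γu) : V.gradL Ω Γu v = v.grad := rfl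

/-- The form `(u, v) ↦ ∫_Ω c u v` on `𝒱`. -/
def massForm (Γu : Set (E d)) (hc : MemLp c ∞ (volume.restrict Ω)) :
    V Ω Γu →L[ℝ] V Ω Γu →L[ℝ] ℝ :=
  (weightedInner ℝ hc).bilinearComp (V.fnL Ω Γu) (V.fnL Ω Γu)

theorem massForm_apply (hc : MemLp c ∞ (volume.restrict Ω)) (u v : V Ω Γu) :
    massForm Γu hc u v = ∫ x in Ω, c x * u.fn x * v.fn x := by
  change weightedInner ℝ hc u.fn v.fn = _
  rw [← integral_weight_inner]
  simp [mul_assoc, mul_comm]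

theorem massForm_comm (hc : MemLp c ∞ (volume.restrict Ω)) (u v : V Ω Γu) :
    massForm Γu hc u v = massForm Γu hc v u := by
  simp only [massForm_apply, mul_assoc, mul_comm (u.fn _)]

theorem massForm_self_nonneg (hc : MemLp c ∞ (volume.restrict Ω))
    (hc0 : ∀ᵐ x ∂(volume.restrict Ω), 0 ≤ c x) (u : V Ω Γu) : 0 ≤ massForm Γu hc u u := by
  rw [massForm_apply]
  refine integral_nonneg_of_ae ?_
  filter_upwards [hc0] with x hx
  simp only [Pi.zero_apply, mul_assoc]
  exact mul_nonneg hx (mul_self_nonneg _)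

instance (T : ℝ) : IsFiniteMeasure (timeMeasure T) := by
  unfold timeMeasure; infer_instance

section Extension

variable {X : Type*} [NormedAddCommGroup X]

/-- The extension by zero of a function on `[0, T]`. -/
def extendZero (T : ℝ) (u : ℝ → X) : ℝ → X := (Icc 0 T).indicator u

theorem memLp_extendZero (u : L2Time T X) : MemLp (extendZero T u) 2 volume :=
  (memLp_indicator_iff_restrict measurableSet_Icc).2 (Lp.memLp u)

theorem integrable_extendZero (u : L2Time T X) : Integrable (extendZero T u) :=
  (integrable_indicator_iff measurableSet_Icc).2
    ((Lp.memLp u).integrable (by norm_num) : Integrable u (timeMeasure T))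

theorem extendZero_of_notMem {u : ℝ → X} {t : ℝ} (ht : t ∉ Icc 0 T) : extendZero T u t = 0 :=
  indicator_of_notMem ht u

theorem extendZero_of_mem {u : ℝ → X} {t : ℝ} (ht : t ∈ Icc 0 T) : extendZero T u t = u t :=
  indicator_of_mem ht u

end Extension

theorem integral_extendZero_dual {X : Type*} [NormedAddCommGroup X] [NormedSpace ℝ X]
    (f : ℝ → StrongDual ℝ X) (v : ℝ → X) :
    ∫ t, extendZero T f t (extendZero T v t) = ∫ t, f t (v t) ∂(timeMeasure T) := by
  rw [timeMeasure, ← integral_indicator measurableSet_Icc]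
  refine integral_congr_ae (Filter.Eventually.of_forall fun t => ?_)
  by_cases ht : t ∈ Icc 0 T
  · simp only [extendZero_of_mem ht, indicator_of_mem ht]
  · simp only [extendZero_of_notMem ht, indicator_of_notMem ht, map_zero]

/-- The functional `c u(t)` is the integral of `c ∂u/∂t` from a time at which `u` vanishes. -/
theorem Evolution.massForm_eq_integral (u : Evolution Ω Γu T c) (hT : 0 < T)
    (hc : MemLp c ∞ (volume.restrict Ω)) {t₀ : ℝ} (ht₀ : t₀ ∈ Icc 0 T) (hu : u.VanishesAt t₀) :
    ∀ᵐ t ∂(timeMeasure T), massForm Γu hc (u.toFun t) = ∫ s in t₀..t, extendZero T u.cdt s := by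
  obtain ⟨w, hwc, hwu, hw0⟩ := hu
  have hi := integrable_extendZero u.cdt
  -- Proved for the continuous representative `w` at every time, so that the exceptional null set in
  -- the conclusion does not depend on `v`.
  have main : ∀ v : V Ω Γu, ∀ t ∈ Icc 0 T,
      weightedInner ℝ hc (w t) v.fn = (∫ s in t₀..t, extendZero T u.cdt s) v := by
    intro v
    have hint : ∀ t ∈ Icc 0 T, weightedInner ℝ hc (w t) v.fn
        = weightedInner ℝ hc (w 0) v.fn + ∫ s in (0 : ℝ)..t, u.cdt s v := by
      intro t ht
      refine eq_add_integral_of_weak_deriv (F := fun t => weightedInner ℝ hc (w t) v.fn) hT ?_ ?_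
        ?_ ht
      · exact ((weightedInner ℝ hc).continuous.comp_continuousOn hwc).clm_apply continuousOn_const
      · exact ((ContinuousLinearMap.apply ℝ ℝ v).integrable_comp
          ((Lp.memLp u.cdt).integrable (by norm_num)))
      · intro φ hφ hφc hφs
        rw [← u.weak_deriv v φ hφ hφc hφs]
        refine integral_congr_ae ?_
        filter_upwards [hwu] with s hs
        rw [hs, ← massForm_apply hc]
        rfl
    have hint' : ∀ t ∈ Icc 0 T, weightedInner ℝ hc (w t) v.fn
        = weightedInner ℝ hc (w 0) v.fn + (∫ s in (0 : ℝ)..t, extendZero T u.cdt s) v := by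
      intro t ht
      rw [hint t ht, ContinuousLinearMap.intervalIntegral_apply hi.intervalIntegrable]
      congr 1
      refine intervalIntegral.integral_congr fun s hs => ?_
      rw [uIcc_of_le ht.1] at hs
      simp only [extendZero_of_mem (u := u.cdt) (show s ∈ Icc 0 T from ⟨hs.1, hs.2.trans ht.2⟩)]
    intro t ht
    have h1 := hint' t ht
    have h2 := hint' t₀ ht₀
    rw [hw0, map_zero, zero_apply] at h2
    rw [← intervalIntegral.integral_interval_sub_left (a := 0) hi.intervalIntegrable
      hi.intervalIntegrable, sub_apply]
    linarith
  filter_upwards [hwu, ae_restrict_mem measurableSet_Icc] with t h1 h2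
  ext v
  rw [← main v t h2, h1]
  rfl

theorem integral_extendZero_eq_zero {X : Type*} [NormedAddCommGroup X] [NormedSpace ℝ X]
    {u : ℝ → X} {a b : ℝ} (h : ∀ t ∈ Ioo (min a b) (max a b), t ∉ Icc 0 T) :
    ∫ s in a..b, extendZero T u s = 0 := by
  refine intervalIntegral.integral_zero_ae ?_
  -- The interval integral includes the right end, which may be an end of [0, T] and is not covered
  -- by `h`; it is a null set.
  have h2 : ∀ᵐ t : ℝ, t ≠ max a b := by simp [ae_iff]
  filter_upwards [h2] with t h2 ht
  exact extendZero_of_notMem (h t ⟨ht.1, lt_of_le_of_ne ht.2 h2⟩)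

/-- For t < 0 both sides are zero, so vanishing at 0 lets the extension by zero keep the primitive
formula there. Past T this breaks down in general, since the extension may jump. -/
theorem Evolution.extendZero_forward (u : Evolution Ω Γu T c) (hT : 0 < T)
    (hc : MemLp c ∞ (volume.restrict Ω)) (hu : u.VanishesAt 0) :
    ∀ᵐ t, t ≤ T → massForm Γu hc (extendZero T u.toFun t)
      = ∫ s in (0 : ℝ)..t, extendZero T u.cdt s := by
  have h := (ae_restrict_iff' measurableSet_Icc).1
    (u.massForm_eq_integral hT hc ⟨le_rfl, hT.le⟩ hu)
  filter_upwards [h] with t h htT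
  by_cases ht : t ∈ Icc 0 T
  · rw [extendZero_of_mem ht, h ht]
  · have ht0 : t < 0 := by
      by_contra h'
      exact ht ⟨not_lt.1 h', htT⟩
    rw [extendZero_of_notMem ht, map_zero, integral_extendZero_eq_zero]
    intro s hs
    rw [max_eq_left ht0.le] at hs
    exact fun h' => hs.2.not_ge h'.1

/-- Here vanishing at T removes the jump at T, and both sides are zero for t > T. -/
theorem Evolution.extendZero_backward (u : Evolution Ω Γu T c) (hT : 0 < T)
    (hc : MemLp c ∞ (volume.restrict Ω)) (hu : u.VanishesAt T) :
    ∀ᵐ t, 0 ≤ t → massForm Γu hc (extendZero T u.toFun t)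
      = ∫ s in T..t, extendZero T u.cdt s := by
  have h := (ae_restrict_iff' measurableSet_Icc).1
    (u.massForm_eq_integral hT hc ⟨hT.le, le_rfl⟩ hu)
  filter_upwards [h] with t h ht0
  by_cases ht : t ∈ Icc 0 T
  · rw [extendZero_of_mem ht, h ht]
  · have htT : T < t := by
      by_contra h'
      exact ht ⟨ht0, not_lt.1 h'⟩
    rw [extendZero_of_notMem ht, map_zero, integral_extendZero_eq_zero]
    intro s hs
    rw [min_eq_left htT.le] at hs
    exact fun h' => hs.1.not_ge h'.2

/-- Integration by parts in time for a function that vanishes at `0` and one that vanishes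
at `T`. -/
theorem Evolution.integral_cdt_add_integral_cdt (u a : Evolution Ω Γu T c) (hT : 0 < T)
    (hc : MemLp c ∞ (volume.restrict Ω)) (hu : u.VanishesAt 0) (ha : a.VanishesAt T) :
    (∫ t, u.cdt t (a.toFun t) ∂(timeMeasure T)) + ∫ t, a.cdt t (u.toFun t) ∂(timeMeasure T)
      = 0 := by
  have h := integral_dual_add_integral_dual_eq_zero (T := T) (massForm Γu hc) (massForm_comm hc)
    (memLp_extendZero u.toFun) (memLp_extendZero a.toFun) (memLp_extendZero u.cdt)
    (memLp_extendZero a.cdt) (integrable_extendZero u.toFun) (integrable_extendZero a.toFun)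
    (integrable_extendZero u.cdt) (integrable_extendZero a.cdt)
    (fun _ => extendZero_of_notMem) (fun _ => extendZero_of_notMem)
    (u.extendZero_forward hT hc hu) (a.extendZero_backward hT hc ha)
  rwa [integral_extendZero_dual, integral_extendZero_dual] at h

/-- Positivity of the time derivative on the difference of two functions that vanish at `0`. -/
theorem Evolution.integral_cdt_sub_nonneg (u w : Evolution Ω Γu T c) (hT : 0 < T)
    (hc : MemLp c ∞ (volume.restrict Ω)) (hc0 : ∀ᵐ x ∂(volume.restrict Ω), 0 ≤ c x)
    (hu : u.VanishesAt 0) (hw : w.VanishesAt 0) :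
    0 ≤ ∫ t, (u.cdt t - w.cdt t) (u.toFun t - w.toFun t) ∂(timeMeasure T) := by
  have h := integral_dual_self_nonneg (T := T) (massForm Γu hc) (massForm_comm hc)
    (massForm_self_nonneg hc hc0)
    ((memLp_extendZero u.toFun).sub (memLp_extendZero w.toFun))
    ((memLp_extendZero u.cdt).sub (memLp_extendZero w.cdt))
    ((integrable_extendZero u.toFun).sub (integrable_extendZero w.toFun))
    ((integrable_extendZero u.cdt).sub (integrable_extendZero w.cdt))
    (fun t ht => by simp [extendZero_of_notMem ht]) (by
      filter_upwards [u.extendZero_forward hT hc hu, w.extendZero_forward hT hc hw]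
        with t h1 h2 ht
      simp only [Pi.sub_apply]
      rw [map_sub, h1 ht, h2 ht, intervalIntegral.integral_sub
        (integrable_extendZero u.cdt).intervalIntegrable
        (integrable_extendZero w.cdt).intervalIntegrable])
  have e1 : extendZero T u.toFun - extendZero T w.toFun
      = extendZero T (fun t => u.toFun t - w.toFun t) := (indicator_sub _ _ _).symm
  have e2 : extendZero T u.cdt - extendZero T w.cdt
      = extendZero T (fun t => u.cdt t - w.cdt t) := (indicator_sub _ _ _).symm
  rwa [e1, e2, integral_extendZero_dual] at h

/-! ### Quotient forms with a weight that may vanish -/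

section Inverse

variable {α : Type*} [MeasurableSpace α] {μ : Measure α} {F : Type*} [NormedAddCommGroup F]
  [InnerProductSpace ℝ F] {m : α → ℝ}

/-- The function `a` vanishes where `m` does, and `∫ ‖a‖² / m` is finite. -/
structure FiniteQuotient (m : α → ℝ) (a : Lp F 2 μ) : Prop where
  zero_of_zero : ∀ᵐ x ∂μ, m x = 0 → a x = 0
  integrable : Integrable (fun x => 1 / m x * ‖a x‖ ^ 2) μ

/-- The form `(a, b) ↦ ∫ ⟪a, b⟫ / m`. -/
def quotientForm (m : α → ℝ) (a b : Lp F 2 μ) : ℝ := ∫ x, 1 / m x * ⟪a x, b x⟫ ∂μ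

/-- Cauchy–Schwarz and Young. It dominates mixed quotients by squares; for w = 0 the convention 1 /
0 = 0 makes both sides zero. -/
theorem abs_inv_mul_inner_le {w : ℝ} (hw : 0 ≤ w) (a b : F) :
    |1 / w * ⟪a, b⟫| ≤ 1 / 2 * (1 / w * ‖a‖ ^ 2 + 1 / w * ‖b‖ ^ 2) := by
  have h1 : 0 ≤ 1 / w := by positivity
  rw [abs_mul, abs_of_nonneg h1]
  have h2 := abs_real_inner_le_norm a b
  have h3 : |⟪a, b⟫| ≤ 1 / 2 * (‖a‖ ^ 2 + ‖b‖ ^ 2) := by nlinarith [sq_nonneg (‖a‖ - ‖b‖)]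
  calc 1 / w * |⟪a, b⟫| ≤ 1 / w * (1 / 2 * (‖a‖ ^ 2 + ‖b‖ ^ 2)) := by gcongr
    _ = _ := by ring

theorem FiniteQuotient.integrable_inner {a b : Lp F 2 μ} (ha : FiniteQuotient m a)
    (hb : FiniteQuotient m b) (hm : AEMeasurable m μ) (hm0 : ∀ᵐ x ∂μ, 0 ≤ m x) :
    Integrable (fun x => 1 / m x * ⟪a x, b x⟫) μ := by
  refine ((ha.integrable.add hb.integrable).const_mul (1 / 2)).mono' ?_ ?_
  · exact (hm.const_div 1).aestronglyMeasurable.mul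
      ((Lp.aestronglyMeasurable a).inner (Lp.aestronglyMeasurable b))
  · filter_upwards [hm0] with x hx
    exact abs_inv_mul_inner_le hx _ _

/-- Positivity of the quotient form on `α a + β b + γ m g`. -/
theorem quotientForm_quadratic_nonneg {a b : Lp F 2 μ} (ha : FiniteQuotient m a)
    (hb : FiniteQuotient m b) (hm : MemLp m ∞ μ) (hm0 : ∀ᵐ x ∂μ, 0 ≤ m x) (g : Lp F 2 μ)
    (α β γ : ℝ) :
    0 ≤ α ^ 2 * quotientForm m a a + β ^ 2 * quotientForm m b b + γ ^ 2 * ⟪mulL F hm g, g⟫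
      + 2 * α * β * quotientForm m a b + 2 * α * γ * ⟪a, g⟫ + 2 * β * γ * ⟪b, g⟫ := by
  have hme : AEMeasurable m μ := hm.aestronglyMeasurable.aemeasurable
  have i1 := ha.integrable_inner ha hme hm0
  have i2 := hb.integrable_inner hb hme hm0
  have i3 := L2.integrable_inner (𝕜 := ℝ) (mulL F hm g) g
  have i4 := ha.integrable_inner hb hme hm0
  have i5 := L2.integrable_inner (𝕜 := ℝ) a g
  have i6 := L2.integrable_inner (𝕜 := ℝ) b g
  simp only [quotientForm, L2.inner_def]
  have j1 := i1.const_mul (α ^ 2)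
  have j2 := i2.const_mul (β ^ 2)
  have j3 := i3.const_mul (γ ^ 2)
  have j4 := i4.const_mul (2 * α * β)
  have j5 := i5.const_mul (2 * α * γ)
  have j6 := i6.const_mul (2 * β * γ)
  rw [← integral_const_mul, ← integral_const_mul, ← integral_const_mul, ← integral_const_mul,
    ← integral_const_mul, ← integral_const_mul, ← integral_add j1 j2,
    ← integral_add (by exact j1.add j2) j3, ← integral_add (by exact (j1.add j2).add j3) j4,
    ← integral_add (by exact ((j1.add j2).add j3).add j4) j5,
    ← integral_add (by exact (((j1.add j2).add j3).add j4).add j5) j6]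
  refine integral_nonneg_of_ae ?_
  filter_upwards [hm0, ha.zero_of_zero, hb.zero_of_zero, coeFn_mulL hm g] with x h0 hax hbx hg
  simp only [Pi.zero_apply, hg]
  -- Where `m` vanishes so do `a`, `b` and m g, hence the integrand. Elsewhere it is the square ‖α a
  -- + β b + γ m g‖² / m, in which the weight cancels from the pairings of `a` and `b` with m g.
  rcases h0.eq_or_lt with h | h
  · rw [hax h.symm, hbx h.symm, ← h]
    simp
  · have e : 0 ≤ 1 / m x * ‖α • a x + β • b x + γ • m x • g x‖ ^ 2 := by positivity
    refine e.trans_eq ?_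
    rw [← real_inner_self_eq_norm_sq]
    simp only [inner_add_left, inner_add_right, real_inner_smul_left, real_inner_smul_right,
      real_inner_comm (b x) (a x), real_inner_comm (g x) (a x), real_inner_comm (g x) (b x)]
    field_simp
    ring

/-- If a = q̃ - m g, then q̃ + m g = a + 2 m g, so the averaged flux is a/2 + m g; the weight
cancels in the second part. Where `m` vanishes, `b` makes both sides zero. -/
theorem inner_average_div_ae_eq {a b : Lp F 2 μ} (hb : FiniteQuotient m b)
    (hm0 : ∀ᵐ x ∂μ, 0 ≤ m x) (g : Lp F 2 μ) :
    (fun x => 1 / m x * ⟪b x, (1 / 2 : ℝ) • (a x + (2 : ℝ) • m x • g x)⟫)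
      =ᵐ[μ] fun x => 1 / 2 * (1 / m x * ⟪a x, b x⟫) + ⟪b x, g x⟫ := by
  filter_upwards [hm0, hb.zero_of_zero] with x h0 hbx
  rcases h0.eq_or_lt with h | h
  · rw [hbx h.symm]
    simp
  · simp only [inner_add_right, real_inner_smul_right, real_inner_comm (b x) (a x)]
    field_simp

end Inverse

section Sampling

variable {β : Type*} [MeasurableSpace β] {ν : Measure β} {α : Type*} [MeasurableSpace α]
  {μ : Measure α} {m : α → ℝ}

/-- The integral in time of the quotient form exists if those of the two squares do. -/
theorem integrable_quotientForm (hm : AEMeasurable m μ) (hm0 : ∀ᵐ x ∂μ, 0 ≤ m x)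
    {a b : β → Lp ℝ 2 μ} (ha : AEStronglyMeasurable a ν) (hb : AEStronglyMeasurable b ν)
    (hfa : ∀ᵐ t ∂ν, FiniteQuotient m (a t)) (hfb : ∀ᵐ t ∂ν, FiniteQuotient m (b t))
    (hia : Integrable (fun t => quotientForm m (a t) (a t)) ν)
    (hib : Integrable (fun t => quotientForm m (b t) (b t)) ν) :
    Integrable (fun t => quotientForm m (a t) (b t)) ν := by
  have e : ∀ x y : ℝ, ⟪x, y⟫ = x * y := fun x y => by simp [mul_comm]
  refine ((hia.add hib).const_mul (1 / 2)).mono' ?_ ?_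
  · simp only [quotientForm, e]
    -- The weight 1 / m need not be bounded, so measurability in time does not follow from
    -- continuity of a bilinear form on L².
    refine aestronglyMeasurable_integral_weight (hm.const_div 1).aestronglyMeasurable ?_ ha hb ?_
    · filter_upwards [hm0] with x hx
      positivity
    · filter_upwards [hfa, hfb] with t h1 h2
      simpa only [e] using h1.integrable_inner h2 hm hm0
  · filter_upwards [hfa, hfb] with t h1 h2
    have i1 := h1.integrable_inner h1 hm hm0
    have i2 := h2.integrable_inner h2 hm hm0
    simp only [quotientForm, Pi.add_apply]
    rw [← integral_add i1 i2, ← integral_const_mul]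
    refine norm_integral_le_of_norm_le ((i1.add i2).const_mul (1 / 2)) ?_
    filter_upwards [hm0] with x hx
    simp only [real_inner_self_eq_norm_sq]
    exact abs_inv_mul_inner_le hx _ _

end Sampling

theorem finiteQuotient_of_bounded_below {α : Type*} [MeasurableSpace α] {μ : Measure α} {F : Type*}
    [NormedAddCommGroup F] [InnerProductSpace ℝ F] {m : α → ℝ} (hm : MemLp (fun x => 1 / m x) ∞ μ)
    (hm0 : ∀ᵐ x ∂μ, 0 < m x) (a : Lp F 2 μ) : FiniteQuotient m a where
  zero_of_zero := by
    filter_upwards [hm0] with x hx h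
    exact absurd h hx.ne'
  integrable := by simpa only [real_inner_self_eq_norm_sq] using integrable_weight_inner hm a a

theorem quotientForm_eq_weightedInner {α : Type*} [MeasurableSpace α] {μ : Measure α} {F : Type*}
    [NormedAddCommGroup F] [InnerProductSpace ℝ F] {m : α → ℝ}
    (hm : MemLp (fun x => 1 / m x) ∞ μ) (a b : Lp F 2 μ) :
    quotientForm m a b = weightedInner F hm a b := integral_weight_inner hm a b

theorem memLp_top_of_bounds {α : Type*} [MeasurableSpace α] {μ : Measure α} {m : α → ℝ} {a b : ℝ}
    (hm : AEMeasurable m μ) (h : ∀ᵐ x ∂μ, a ≤ m x ∧ m x ≤ b) : MemLp m ∞ μ :=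
  memLp_top_of_bound hm.aestronglyMeasurable (max |a| |b|) (by
    filter_upwards [h] with x hx
    exact abs_le_max_abs_abs hx.1 hx.2)

namespace AdmissibleCoefficients

theorem memLp_c (h : AdmissibleCoefficients Ω c k r) : MemLp c ∞ (volume.restrict Ω) := by
  obtain ⟨_, _, _, h1⟩ := h.c_bound
  exact memLp_top_of_bounds h.c_meas h1

theorem memLp_k (h : AdmissibleCoefficients Ω c k r) : MemLp k ∞ (volume.restrict Ω) := by
  obtain ⟨_, _, _, h1⟩ := h.k_bound
  exact memLp_top_of_bounds h.k_meas h1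

theorem memLp_r (h : AdmissibleCoefficients Ω c k r) : MemLp r ∞ (volume.restrict Ω) := by
  obtain ⟨_, h1⟩ := h.r_bound
  exact memLp_top_of_bounds h.r_meas h1

theorem c_nonneg (h : AdmissibleCoefficients Ω c k r) : ∀ᵐ x ∂(volume.restrict Ω), 0 ≤ c x := by
  obtain ⟨_, _, h0, h1⟩ := h.c_bound
  filter_upwards [h1] with x hx
  exact h0.le.trans hx.1

theorem k_pos (h : AdmissibleCoefficients Ω c k r) : ∀ᵐ x ∂(volume.restrict Ω), 0 < k x := by
  obtain ⟨_, _, h0, h1⟩ := h.k_bound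
  filter_upwards [h1] with x hx
  exact h0.trans_le hx.1

theorem r_nonneg (h : AdmissibleCoefficients Ω c k r) : ∀ᵐ x ∂(volume.restrict Ω), 0 ≤ r x := by
  obtain ⟨_, h1⟩ := h.r_bound
  filter_upwards [h1] with x hx
  exact hx.1

theorem memLp_inv_k (h : AdmissibleCoefficients Ω c k r) : MemLp (fun x => 1 / k x) ∞ (volume.restrict Ω) := by
  obtain ⟨k₀, k₁, h0, h1⟩ := h.k_bound
  refine memLp_top_of_bounds (a := 0) (b := 1 / k₀) (h.k_meas.const_div 1) ?_
  filter_upwards [h1] with x hx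
  have := h0.trans_le hx.1
  exact ⟨by positivity, one_div_le_one_div_of_le h0 hx.1⟩

end AdmissibleCoefficients

/-! ### Gaps in the constitutive relations and their integrals in space -/

/-- The error `q - k∇v` in the constitutive relation of the flux. -/
def fluxGap (hk : MemLp k ∞ (volume.restrict Ω)) (q : L2Vec Ω) (v : V Ω Γu) : L2Vec Ω :=
  q - mulL (E d) hk v.grad

/-- The error `z - rv` in the constitutive relation of the reaction term. -/
def reactionGap (hr : MemLp r ∞ (volume.restrict Ω)) (z : L2 Ω) (v : V Ω Γu) : L2 Ω :=
  z - mulL ℝ hr v.fn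

theorem coeFn_fluxGap (hk : MemLp k ∞ (volume.restrict Ω)) (q : L2Vec Ω) (v : V Ω Γu) :
    fluxGap hk q v =ᵐ[volume.restrict Ω] fun x => q x - k x • v.grad x := by
  filter_upwards [Lp.coeFn_sub q (mulL (E d) hk v.grad), coeFn_mulL hk v.grad] with x h1 h2
  rw [fluxGap, h1, Pi.sub_apply, h2]

theorem coeFn_reactionGap (hr : MemLp r ∞ (volume.restrict Ω)) (z : L2 Ω) (v : V Ω Γu) :
    reactionGap hr z v =ᵐ[volume.restrict Ω] fun x => z x - r x * v.fn x := by
  filter_upwards [Lp.coeFn_sub z (mulL ℝ hr v.fn), coeFn_mulL hr v.fn] with x h1 h2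
  rw [reactionGap, h1, Pi.sub_apply, h2, smul_eq_mul]

/-- Where r = 0 the gap is z itself, so the condition on z is exactly what is needed. -/
theorem finiteQuotient_reactionGap (hr : MemLp r ∞ (volume.restrict Ω)) {z : L2 Ω} {v : V Ω Γu}
    (h0 : ∀ᵐ x ∂(volume.restrict Ω), r x = 0 → z x = 0)
    (hi : Integrable (fun x => 1 / r x * (z x - r x * v.fn x) ^ 2) (volume.restrict Ω)) :
    FiniteQuotient r (reactionGap hr z v) where
  zero_of_zero := by
    filter_upwards [h0, coeFn_reactionGap hr z v] with x h1 h2 h3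
    rw [h2, h1 h3, h3]
    simp
  integrable := by
    refine hi.congr ?_
    filter_upwards [coeFn_reactionGap hr z v] with x h2
    rw [h2, Real.norm_eq_abs, sq_abs]

theorem quotientForm_reactionGap (hr : MemLp r ∞ (volume.restrict Ω)) (z : L2 Ω) (v : V Ω Γu) :
    quotientForm r (reactionGap hr z v) (reactionGap hr z v)
      = ∫ x in Ω, 1 / r x * (z x - r x * v.fn x) ^ 2 := by
  refine integral_congr_ae ?_
  filter_upwards [coeFn_reactionGap hr z v] with x h2
  rw [real_inner_self_eq_norm_sq, h2, Real.norm_eq_abs, sq_abs]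

/-- The work `∫_Ω (q · ∇v + z v)` of the flux `q` and the reaction `z` on `v`. -/
theorem integral_inner_grad_add (q : L2Vec Ω) (z : L2 Ω) (v : V Ω Γu) :
    ∫ x in Ω, (⟪q x, v.grad x⟫ + z x * v.fn x) = ⟪q, v.grad⟫ + ⟪z, v.fn⟫ := by
  rw [integral_add (L2.integrable_inner (𝕜 := ℝ) q v.grad) (integrable_mul_L2 z v.fn),
    L2.inner_def, L2_inner_real]

theorem integral_energy (hk : MemLp k ∞ (volume.restrict Ω)) (hr : MemLp r ∞ (volume.restrict Ω))
    (u v : V Ω Γu) :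
    ∫ x in Ω, (k x * ⟪u.grad x, v.grad x⟫ + r x * u.fn x * v.fn x)
      = ⟪mulL (E d) hk u.grad, v.grad⟫ + ⟪mulL ℝ hr u.fn, v.fn⟫ := by
  rw [← integral_inner_grad_add]
  refine integral_congr_ae ?_
  filter_upwards [coeFn_mulL hk u.grad, coeFn_mulL hr u.fn] with x h1 h2
  rw [h1, h2, real_inner_smul_left, smul_eq_mul]

section Space

variable (h : AdmissibleCoefficients Ω c k r) {q qa : L2Vec Ω} {z za : L2 Ω} {u ua : V Ω Γu}

theorem AdmissibleCoefficients.finiteQuotient_k (h : AdmissibleCoefficients Ω c k r)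
    (q : L2Vec Ω) : FiniteQuotient k q :=
  finiteQuotient_of_bounded_below h.memLp_inv_k h.k_pos q

theorem creSpaceSq_eq (hz : FiniteQuotient r (reactionGap h.memLp_r z u)) :
    creSpaceSq k r u q z
      = quotientForm k (fluxGap h.memLp_k q u) (fluxGap h.memLp_k q u)
        + quotientForm r (reactionGap h.memLp_r z u) (reactionGap h.memLp_r z u) := by
  have i1 := (h.finiteQuotient_k (fluxGap h.memLp_k q u)).integrable_inner
    (h.finiteQuotient_k (fluxGap h.memLp_k q u)) h.k_meas (h.k_pos.mono fun _ => le_of_lt)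
  have i2 := hz.integrable_inner hz h.r_meas h.r_nonneg
  rw [quotientForm, quotientForm, ← integral_add i1 i2]
  refine integral_congr_ae ?_
  filter_upwards [coeFn_fluxGap h.memLp_k q u, coeFn_reactionGap h.memLp_r z u] with x h1 h2
  rw [real_inner_self_eq_norm_sq, real_inner_self_eq_norm_sq, h1, h2, Real.norm_eq_abs, sq_abs]

/-- The factor 1/2 arises because subtracting (k∇u, ru) from the average of (q, z) and (k∇u, ru)
leaves half the gap. -/
theorem integral_corrShift_eq (hz : FiniteQuotient r (reactionGap h.memLp_r z u))
    (hza : FiniteQuotient r (reactionGap h.memLp_r za ua)) :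
    ∫ x in Ω, (1 / k x * ⟪qa x - k x • ua.grad x,
          (1 / 2 : ℝ) • (q x + k x • u.grad x) - k x • u.grad x⟫
        + 1 / r x * (za x - r x * ua.fn x) * (1 / 2 * (z x + r x * u.fn x) - r x * u.fn x))
      = 1 / 2 * (quotientForm k (fluxGap h.memLp_k qa ua) (fluxGap h.memLp_k q u)
        + quotientForm r (reactionGap h.memLp_r za ua) (reactionGap h.memLp_r z u)) := by
  have i1 := (h.finiteQuotient_k (fluxGap h.memLp_k qa ua)).integrable_inner
    (h.finiteQuotient_k (fluxGap h.memLp_k q u)) h.k_meas (h.k_pos.mono fun _ => le_of_lt)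
  have i2 := hza.integrable_inner hz h.r_meas h.r_nonneg
  rw [quotientForm, quotientForm, ← integral_add i1 i2, ← integral_const_mul]
  refine integral_congr_ae ?_
  filter_upwards [coeFn_fluxGap h.memLp_k q u, coeFn_reactionGap h.memLp_r z u,
    coeFn_fluxGap h.memLp_k qa ua, coeFn_reactionGap h.memLp_r za ua] with x h1 h2 h3 h4
  have e : (1 / 2 : ℝ) • (q x + k x • u.grad x) - k x • u.grad x
      = (1 / 2 : ℝ) • (q x - k x • u.grad x) := by module
  rw [h1, h2, h3, h4, e, real_inner_smul_right]
  simp only [RCLike.inner_apply, conj_trivial]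
  ring

/-- The averaged adjoint pair is half the adjoint gap plus (k∇ũ, rũ). The first part gives the mixed
quotient forms; in the second the weights cancel and leave the work of the primal gap on ũ. -/
theorem integral_Qcorr_eq (hz : FiniteQuotient r (reactionGap h.memLp_r z u))
    (hza : FiniteQuotient r (reactionGap h.memLp_r za ua)) :
    ∫ x in Ω, (1 / k x * ⟪q x - k x • u.grad x, (1 / 2 : ℝ) • (qa x + k x • ua.grad x)⟫
        + 1 / r x * (z x - r x * u.fn x) * (1 / 2 * (za x + r x * ua.fn x)))
      = 1 / 2 * (quotientForm k (fluxGap h.memLp_k qa ua) (fluxGap h.memLp_k q u)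
          + quotientForm r (reactionGap h.memLp_r za ua) (reactionGap h.memLp_r z u))
        + (⟪fluxGap h.memLp_k q u, ua.grad⟫ + ⟪reactionGap h.memLp_r z u, ua.fn⟫) := by
  have i1 := ((h.finiteQuotient_k (fluxGap h.memLp_k qa ua)).integrable_inner
    (h.finiteQuotient_k (fluxGap h.memLp_k q u)) h.k_meas
    (h.k_pos.mono fun _ => le_of_lt)).const_mul (1 / 2)
  have i2 := (hza.integrable_inner hz h.r_meas h.r_nonneg).const_mul (1 / 2)
  have i3 := L2.integrable_inner (𝕜 := ℝ) (fluxGap h.memLp_k q u) ua.grad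
  have i4 := L2.integrable_inner (𝕜 := ℝ) (reactionGap h.memLp_r z u) ua.fn
  rw [quotientForm, quotientForm, L2.inner_def, L2.inner_def, mul_add, ← integral_const_mul,
    ← integral_const_mul, ← integral_add i1 i2, ← integral_add i3 i4,
    ← integral_add (by exact i1.add i2) (by exact i3.add i4)]
  refine integral_congr_ae ?_
  filter_upwards [coeFn_fluxGap h.memLp_k q u, coeFn_reactionGap h.memLp_r z u,
    coeFn_fluxGap h.memLp_k qa ua, coeFn_reactionGap h.memLp_r za ua,
    inner_average_div_ae_eq (a := fluxGap h.memLp_k qa ua)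
      (h.finiteQuotient_k (fluxGap h.memLp_k q u)) (h.k_pos.mono fun _ => le_of_lt) ua.grad,
    inner_average_div_ae_eq (a := reactionGap h.memLp_r za ua) hz h.r_nonneg ua.fn]
    with x h1 h2 h3 h4 h5 h6
  have e1 : (1 / 2 : ℝ) • (qa x + k x • ua.grad x)
      = (1 / 2 : ℝ) • (fluxGap h.memLp_k qa ua x + (2 : ℝ) • k x • ua.grad x) := by
    rw [h3]; module
  have e2 : 1 / r x * (z x - r x * u.fn x) * (1 / 2 * (za x + r x * ua.fn x))
      = 1 / r x * ⟪reactionGap h.memLp_r z u x,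
        (1 / 2 : ℝ) • (reactionGap h.memLp_r za ua x + (2 : ℝ) • r x • ua.fn x)⟫ := by
    rw [h2, h4]
    simp only [RCLike.inner_apply, conj_trivial, smul_eq_mul]
    ring
  rw [e1, e2, ← h1, h5, h6]
  ring

end Space

/-! ### Cauchy–Schwarz and the ball containing the error -/

theorem sq_le_mul_of_quadratic_nonneg {a b c : ℝ} (h : ∀ x : ℝ, 0 ≤ a * (x * x) + 2 * b * x + c) :
    b ^ 2 ≤ a * c := by
  have := discrim_le_zero h
  rw [discrim] at this
  linarith

/-- Bounds for the entries of a positive semidefinite symmetric form on three vectors `A`, `B`, `G`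
with `⟪G, G⟫ ≤ ⟪B, G⟫`: the vector `G` lies in the ball with center `B / 2` and radius
`‖B‖ / 2`. -/
theorem abs_le_of_form_nonneg {AA BB GG AB AG BG : ℝ}
    (h : ∀ α β γ : ℝ, 0 ≤ α ^ 2 * AA + β ^ 2 * BB + γ ^ 2 * GG + 2 * α * β * AB + 2 * α * γ * AG
      + 2 * β * γ * BG) (hG : GG ≤ BG) :
    |AG| ≤ √AA * √BB ∧ |AG - 1 / 2 * AB| ≤ 1 / 2 * √AA * √BB := by
  have hAA : 0 ≤ AA := by simpa using h 1 0 0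
  have hBB : 0 ≤ BB := by simpa using h 0 1 0
  have hGG : 0 ≤ GG := by simpa using h 0 0 1
  have h1 : AG ^ 2 ≤ AA * GG := sq_le_mul_of_quadratic_nonneg fun x => by
    have := h x 0 1
    linarith
  have h2 : BG ^ 2 ≤ BB * GG := sq_le_mul_of_quadratic_nonneg fun x => by
    have := h 0 x 1
    linarith
  -- Cauchy–Schwarz for A and G - B/2, hence β = -1/2. The second factor is the square of G - B/2,
  -- which `hG` bounds by BB/4.
  have h3 : (AG - 1 / 2 * AB) ^ 2 ≤ AA * (GG + 1 / 4 * BB - BG) :=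
    sq_le_mul_of_quadratic_nonneg fun x => by
      have := h x (-1 / 2) 1
      linarith
  -- From GG² ≤ BG² ≤ BB · GG, dividing by GG when it is positive.
  have h4 : GG ≤ BB := by
    rcases hGG.eq_or_lt with h0 | h0
    · rwa [← h0]
    · nlinarith
  rw [mul_assoc, ← Real.sqrt_mul hAA]
  constructor
  · exact Real.abs_le_sqrt (h1.trans (by gcongr))
  · have h5 : (2 * (AG - 1 / 2 * AB)) ^ 2 ≤ AA * BB := by nlinarith
    have h6 := Real.abs_le_sqrt h5
    rw [abs_mul, abs_of_pos (zero_lt_two' ℝ)] at h6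
    linarith

/-! ### Work, energy and the equilibrium equations -/

/-- The work `∫_Ω (q · ∇v + z v)` of the flux `q` and the reaction `z` on `v`. -/
def work (q : L2Vec Ω) (z : L2 Ω) (v : V Ω Γu) : ℝ := ⟪q, v.grad⟫ + ⟪z, v.fn⟫

/-- The energy form `∫_Ω (k ∇u · ∇v + r u v)`. -/
def energy (hk : MemLp k ∞ (volume.restrict Ω)) (hr : MemLp r ∞ (volume.restrict Ω))
    (u v : V Ω Γu) : ℝ := work (mulL (E d) hk u.grad) (mulL ℝ hr u.fn) v

theorem work_sub (q : L2Vec Ω) (z : L2 Ω) (v w : V Ω Γu) :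
    work q z (v - w) = work q z v - work q z w := by
  simp only [work, ← V.fnL_apply, ← V.gradL_apply, map_sub, inner_sub_right]
  ring

theorem energy_comm (hk : MemLp k ∞ (volume.restrict Ω)) (hr : MemLp r ∞ (volume.restrict Ω))
    (u v : V Ω Γu) : energy hk hr u v = energy hk hr v u := by
  rw [energy, energy, work, work, mulL_inner_comm, mulL_inner_comm hr]

theorem energy_sub_left (hk : MemLp k ∞ (volume.restrict Ω))
    (hr : MemLp r ∞ (volume.restrict Ω)) (u w v : V Ω Γu) :
    energy hk hr (u - w) v = energy hk hr u v - energy hk hr w v := by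
  rw [energy_comm, energy_comm hk hr u, energy_comm hk hr w]
  exact work_sub _ _ _ _

/-- The left side is the weighted product of the gap with (k∇v, rv) after cancelling the weights.
This links the geometry of the gaps to the equilibrium equations. -/
theorem work_gap (hk : MemLp k ∞ (volume.restrict Ω)) (hr : MemLp r ∞ (volume.restrict Ω))
    (q : L2Vec Ω) (z : L2 Ω) (u v : V Ω Γu) :
    work (fluxGap hk q u) (reactionGap hr z u) v = work q z v - energy hk hr u v := by
  simp only [work, energy, fluxGap, reactionGap, inner_sub_left]
  ring

section Integrability

variable {ν : Measure ℝ}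

theorem memLp_fluxGap (hk : MemLp k ∞ (volume.restrict Ω)) {q : ℝ → L2Vec Ω} {v : ℝ → V Ω Γu}
    (hq : MemLp q 2 ν) (hv : MemLp v 2 ν) : MemLp (fun t => fluxGap hk (q t) (v t)) 2 ν :=
  hq.sub (((mulL (E d) hk).comp (V.gradL Ω Γu)).comp_memLp' hv)

theorem memLp_reactionGap (hr : MemLp r ∞ (volume.restrict Ω)) {z : ℝ → L2 Ω} {v : ℝ → V Ω Γu}
    (hz : MemLp z 2 ν) (hv : MemLp v 2 ν) : MemLp (fun t => reactionGap hr (z t) (v t)) 2 ν :=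
  hz.sub (((mulL ℝ hr).comp (V.fnL Ω Γu)).comp_memLp' hv)

theorem integrable_work {q : ℝ → L2Vec Ω} {z : ℝ → L2 Ω} {v : ℝ → V Ω Γu}
    (hq : MemLp q 2 ν) (hz : MemLp z 2 ν) (hv : MemLp v 2 ν) :
    Integrable (fun t => work (q t) (z t) (v t)) ν :=
  (integrable_bilin (innerSL ℝ) hq ((V.gradL Ω Γu).comp_memLp' hv)).add
    (integrable_bilin (innerSL ℝ) hz ((V.fnL Ω Γu).comp_memLp' hv))

theorem integrable_energy (hk : MemLp k ∞ (volume.restrict Ω))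
    (hr : MemLp r ∞ (volume.restrict Ω)) {u v : ℝ → V Ω Γu} (hu : MemLp u 2 ν) (hv : MemLp v 2 ν) :
    Integrable (fun t => energy hk hr (u t) (v t)) ν :=
  integrable_work (((mulL (E d) hk).comp (V.gradL Ω Γu)).comp_memLp' hu)
    (((mulL ℝ hr).comp (V.fnL Ω Γu)).comp_memLp' hu) hv

end Integrability

theorem integrable_cdt (u : Evolution Ω Γu T c) {v : ℝ → V Ω Γu}
    (hv : MemLp v 2 (timeMeasure T)) : Integrable (fun t => u.cdt t (v t)) (timeMeasure T) :=
  integrable_dual_apply (Lp.memLp u.cdt) hv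

theorem b_eq (hk : MemLp k ∞ (volume.restrict Ω)) (hr : MemLp r ∞ (volume.restrict Ω))
    (u : Evolution Ω Γu T c) (v : L2Time T (V Ω Γu)) :
    b k r u v = (∫ t, u.cdt t (v t) ∂(timeMeasure T))
      + ∫ t, energy hk hr (u.toFun t) (v t) ∂(timeMeasure T) := by
  rw [← integral_add (integrable_cdt u (Lp.memLp v))
    (integrable_energy hk hr (Lp.memLp u.toFun) (Lp.memLp v))]
  simp only [b, energy, work, integral_energy hk hr]

/-- The null set of times in the equilibrium is common to all test functions, so at almost every t
the value v(t) may be inserted. -/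
theorem IsAdjointAdmissible.Q_eq {qS : L2Time T (L2Vec Ω)} {fS : L2Time T (L2 Ω)}
    {u : Evolution Ω Γu T c} {q : L2Time T (L2Vec Ω)} {z : L2Time T (L2 Ω)}
    (h : IsAdjointAdmissible qS fS u q z) (v : L2Time T (V Ω Γu)) :
    Q qS fS v = -(∫ t, u.cdt t (v t) ∂(timeMeasure T))
      + ∫ t, work (q t) (z t) (v t) ∂(timeMeasure T) := by
  rw [← integral_neg, ← integral_add (by exact (integrable_cdt u (Lp.memLp v)).neg)
    (integrable_work (Lp.memLp q) (Lp.memLp z) (Lp.memLp v))]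
  refine integral_congr_ae ?_
  filter_upwards [h.equilibrium] with t ht
  rw [← ht (v t), integral_inner_grad_add, work]

theorem IsPrimalAdmissible.l_eq {Γq : Set (E d)} {f : L2Time T (L2 Ω)}
    {g : L2Time T (Lp ℝ 2 ((surfaceMeasure Ω).restrict Γq))}
    {u : Evolution Ω Γu T c} {q : L2Time T (L2Vec Ω)} {z : L2Time T (L2 Ω)}
    (h : IsPrimalAdmissible f g u q z) (v : L2Time T (V Ω Γu)) :
    l f g v = (∫ t, u.cdt t (v t) ∂(timeMeasure T))
      + ∫ t, work (q t) (z t) (v t) ∂(timeMeasure T) := by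
  rw [← integral_add (integrable_cdt u (Lp.memLp v))
    (integrable_work (Lp.memLp q) (Lp.memLp z) (Lp.memLp v))]
  refine integral_congr_ae ?_
  filter_upwards [h.equilibrium] with t ht
  rw [← ht (v t), integral_inner_grad_add, work]

/-! ### The space-time form on gaps -/

section Gap

variable (h : AdmissibleCoefficients Ω c k r)

/-- The form `∫_Ω (1/k X · Y + 1/r x y)` of the gaps of two pairs of fluxes and reactions. -/
def gapForm (u : Evolution Ω Γu T c) (q : L2Time T (L2Vec Ω)) (z : L2Time T (L2 Ω))
    (u' : Evolution Ω Γu T c) (q' : L2Time T (L2Vec Ω)) (z' : L2Time T (L2 Ω)) (t : ℝ) : ℝ :=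
  quotientForm k (fluxGap h.memLp_k (q t) (u.toFun t)) (fluxGap h.memLp_k (q' t) (u'.toFun t))
    + quotientForm r (reactionGap h.memLp_r (z t) (u.toFun t))
      (reactionGap h.memLp_r (z' t) (u'.toFun t))

variable {h} {u u' : Evolution Ω Γu T c} {q q' : L2Time T (L2Vec Ω)} {z z' : L2Time T (L2 Ω)}

theorem HasFiniteCRE.finiteQuotient (h : AdmissibleCoefficients Ω c k r)
    (hz : HasFiniteCRE r u z) :
    ∀ᵐ t ∂(timeMeasure T), FiniteQuotient r (reactionGap h.memLp_r (z t) (u.toFun t)) := by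
  filter_upwards [hz.zero_of_zero, hz.integrable_space] with t h1 h2
  exact finiteQuotient_reactionGap h.memLp_r h1 h2

/-- The flux part is a bounded bilinear form of L² functions because 1/k is bounded. Only the
reaction part draws on the finiteness of the two errors. -/
theorem integrable_gapForm (hz : HasFiniteCRE r u z) (hz' : HasFiniteCRE r u' z') :
    Integrable (gapForm h u q z u' q' z') (timeMeasure T) := by
  refine Integrable.add ?_ ?_
  · simp only [quotientForm_eq_weightedInner h.memLp_inv_k]
    exact integrable_bilin _ (memLp_fluxGap _ (Lp.memLp q) (Lp.memLp u.toFun))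
      (memLp_fluxGap _ (Lp.memLp q') (Lp.memLp u'.toFun))
  · refine integrable_quotientForm h.r_meas h.r_nonneg
      (memLp_reactionGap _ (Lp.memLp z) (Lp.memLp u.toFun)).aestronglyMeasurable
      (memLp_reactionGap _ (Lp.memLp z') (Lp.memLp u'.toFun)).aestronglyMeasurable
      (hz.finiteQuotient h) (hz'.finiteQuotient h) ?_ ?_
    · simpa only [quotientForm_reactionGap] using hz.integrable_time
    · simpa only [quotientForm_reactionGap] using hz'.integrable_time

theorem cre_eq (hz : HasFiniteCRE r u z) :
    cre k r u q z = √(∫ t, gapForm h u q z u q z t ∂(timeMeasure T)) := by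
  rw [cre]
  congr 1
  refine integral_congr_ae ?_
  filter_upwards [hz.finiteQuotient h] with t ht
  exact creSpaceSq_eq h ht

theorem corrShift_eq (hz : HasFiniteCRE r u z) (hz' : HasFiniteCRE r u' z') :
    corrShift k r u q z u' q' z'
      = 1 / 2 * ∫ t, gapForm h u' q' z' u q z t ∂(timeMeasure T) := by
  rw [corrShift, ← integral_const_mul]
  refine integral_congr_ae ?_
  filter_upwards [hz.finiteQuotient h, hz'.finiteQuotient h] with t h1 h2
  exact integral_corrShift_eq h h1 h2

theorem Qcorr_eq (hz : HasFiniteCRE r u z) (hz' : HasFiniteCRE r u' z') :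
    Qcorr k r u q z u' q' z'
      = 1 / 2 * (∫ t, gapForm h u' q' z' u q z t ∂(timeMeasure T))
        + ((∫ t, work (q t) (z t) (u'.toFun t) ∂(timeMeasure T))
          - ∫ t, energy h.memLp_k h.memLp_r (u.toFun t) (u'.toFun t) ∂(timeMeasure T)) := by
  have i2 := integrable_work (Lp.memLp q) (Lp.memLp z) (Lp.memLp u'.toFun)
  have i3 := integrable_energy h.memLp_k h.memLp_r (Lp.memLp u.toFun) (Lp.memLp u'.toFun)
  rw [Qcorr, ← integral_const_mul, ← integral_sub i2 i3,
    ← integral_add ((integrable_gapForm hz' hz).const_mul _) (by exact i2.sub i3)]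
  refine integral_congr_ae ?_
  filter_upwards [hz.finiteQuotient h, hz'.finiteQuotient h] with t h1 h2
  rw [← work_gap]
  exact integral_Qcorr_eq h h1 h2

/-- Positivity of the form `∫_I ∫_Ω (1/k X · Y + 1/r x y)` on the combinations of two gaps and of
the pair `(k∇v, rv)`. -/
theorem gapForm_quadratic_nonneg (hz : HasFiniteCRE r u z) (hz' : HasFiniteCRE r u' z')
    {v : ℝ → V Ω Γu} (hv : MemLp v 2 (timeMeasure T)) (α β γ : ℝ) :
    0 ≤ α ^ 2 * (∫ t, gapForm h u q z u q z t ∂(timeMeasure T))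
      + β ^ 2 * (∫ t, gapForm h u' q' z' u' q' z' t ∂(timeMeasure T))
      + γ ^ 2 * (∫ t, energy h.memLp_k h.memLp_r (v t) (v t) ∂(timeMeasure T))
      + 2 * α * β * (∫ t, gapForm h u q z u' q' z' t ∂(timeMeasure T))
      + 2 * α * γ * (∫ t, (work (q t) (z t) (v t)
          - energy h.memLp_k h.memLp_r (u.toFun t) (v t)) ∂(timeMeasure T))
      + 2 * β * γ * (∫ t, (work (q' t) (z' t) (v t)
          - energy h.memLp_k h.memLp_r (u'.toFun t) (v t)) ∂(timeMeasure T)) := by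
  have j1 := (integrable_gapForm (h := h) (q := q) (q' := q) hz hz).const_mul (α ^ 2)
  have j2 := (integrable_gapForm (h := h) (q := q') (q' := q') hz' hz').const_mul (β ^ 2)
  have j3 := (integrable_energy h.memLp_k h.memLp_r hv hv).const_mul (γ ^ 2)
  have j4 := (integrable_gapForm (h := h) (q := q) (q' := q') hz hz').const_mul (2 * α * β)
  have j5 := ((integrable_work (Lp.memLp q) (Lp.memLp z) hv).sub
    (integrable_energy h.memLp_k h.memLp_r (Lp.memLp u.toFun) hv)).const_mul (2 * α * γ)
  have j6 := ((integrable_work (Lp.memLp q') (Lp.memLp z') hv).sub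
    (integrable_energy h.memLp_k h.memLp_r (Lp.memLp u'.toFun) hv)).const_mul (2 * β * γ)
  rw [← integral_const_mul, ← integral_const_mul, ← integral_const_mul, ← integral_const_mul,
    ← integral_const_mul, ← integral_const_mul, ← integral_add j1 j2,
    ← integral_add (by exact j1.add j2) j3, ← integral_add (by exact (j1.add j2).add j3) j4,
    ← integral_add (by exact ((j1.add j2).add j3).add j4) (by exact j5),
    ← integral_add (by exact (((j1.add j2).add j3).add j4).add j5) (by exact j6)]
  refine integral_nonneg_of_ae ?_
  filter_upwards [hz.finiteQuotient h, hz'.finiteQuotient h] with t h1 h2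
  have p1 := quotientForm_quadratic_nonneg
    (h.finiteQuotient_k (fluxGap h.memLp_k (q t) (u.toFun t)))
    (h.finiteQuotient_k (fluxGap h.memLp_k (q' t) (u'.toFun t))) h.memLp_k
    (h.k_pos.mono fun _ => le_of_lt) (v t).grad α β γ
  have p2 := quotientForm_quadratic_nonneg h1 h2 h.memLp_r h.r_nonneg (v t).fn α β γ
  -- Brings the cross terms to inner products of gaps with ∇v and v, so that the flux and reaction
  -- inequalities add up to the claim at time t.
  rw [← work_gap, ← work_gap]
  simp only [Pi.zero_apply, gapForm, energy, work]
  linarith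

end Gap

/-! ### Error identities and bounds for the output -/

section Bounds

variable {Γq : Set (E d)} {f : L2Time T (L2 Ω)}
  {g : L2Time T (Lp ℝ 2 ((surfaceMeasure Ω).restrict Γq))} {qS : L2Time T (L2Vec Ω)}
  {fS : L2Time T (L2 Ω)} {u um ua : Evolution Ω Γu T c} {qm qa : L2Time T (L2Vec Ω)}
  {zm za : L2Time T (L2 Ω)}

/-- The energy of the error `u - u_m` is at most the work of the primal gap on it. -/
theorem integral_energy_error_le (hT : 0 < T) (h : AdmissibleCoefficients Ω c k r)
    (hu : IsWeakSolution k r f g u) (hm : IsPrimalAdmissible f g um qm zm) :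
    ∫ t, energy h.memLp_k h.memLp_r ((u.toFun - um.toFun : L2Time T (V Ω Γu)) t)
        ((u.toFun - um.toFun : L2Time T (V Ω Γu)) t) ∂(timeMeasure T)
      ≤ ∫ t, (work (qm t) (zm t) ((u.toFun - um.toFun : L2Time T (V Ω Γu)) t)
          - energy h.memLp_k h.memLp_r (um.toFun t)
            ((u.toFun - um.toFun : L2Time T (V Ω Γu)) t)) ∂(timeMeasure T) := by
  have he := Lp.coeFn_sub u.toFun um.toFun
  set e : L2Time T (V Ω Γu) := u.toFun - um.toFun
  have hpos := Evolution.integral_cdt_sub_nonneg u um hT h.memLp_c h.c_nonneg hu.1 hm.initial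
  have e1 : ∫ t, (u.cdt t - um.cdt t) (u.toFun t - um.toFun t) ∂(timeMeasure T)
      = (∫ t, u.cdt t (e t) ∂(timeMeasure T)) - ∫ t, um.cdt t (e t) ∂(timeMeasure T) := by
    rw [← integral_sub (integrable_cdt u (Lp.memLp e)) (integrable_cdt um (Lp.memLp e))]
    refine integral_congr_ae ?_
    filter_upwards [he] with t ht
    rw [ht]
    rfl
  have e2 : ∫ t, energy h.memLp_k h.memLp_r (e t) (e t) ∂(timeMeasure T)
      = (∫ t, energy h.memLp_k h.memLp_r (u.toFun t) (e t) ∂(timeMeasure T))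
        - ∫ t, energy h.memLp_k h.memLp_r (um.toFun t) (e t) ∂(timeMeasure T) := by
    rw [← integral_sub (integrable_energy _ _ (Lp.memLp u.toFun) (Lp.memLp e))
      (integrable_energy _ _ (Lp.memLp um.toFun) (Lp.memLp e))]
    refine integral_congr_ae ?_
    filter_upwards [he] with t ht
    rw [← energy_sub_left]
    congr 1
  -- Both b(u, e) and the work of the equilibrated pair express l(e). Their difference is the energy
  -- balance of the error, from which `hpos` drops the time term.
  have hb := hu.2 e
  rw [b_eq h.memLp_k h.memLp_r, hm.l_eq e] at hb
  rw [e2, integral_sub (integrable_work (Lp.memLp qm) (Lp.memLp zm) (Lp.memLp e))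
    (integrable_energy _ _ (Lp.memLp um.toFun) (Lp.memLp e))]
  linarith

/-- The error on the output, corrected by the residual, is the work of the adjoint gap on the error
`u - u_m`. -/
theorem Q_sub_Q_sub_R_eq (hT : 0 < T) (h : AdmissibleCoefficients Ω c k r)
    (hu : IsWeakSolution k r f g u) (hm : IsPrimalAdmissible f g um qm zm)
    (ha : IsAdjointAdmissible qS fS ua qa za) :
    Q qS fS u.toFun - Q qS fS um.toFun - R k r f g um ua.toFun
      = ∫ t, (work (qa t) (za t) ((u.toFun - um.toFun : L2Time T (V Ω Γu)) t)
          - energy h.memLp_k h.memLp_r (ua.toFun t)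
            ((u.toFun - um.toFun : L2Time T (V Ω Γu)) t)) ∂(timeMeasure T) := by
  have i1 := integrable_work (Lp.memLp qa) (Lp.memLp za) (Lp.memLp u.toFun)
  have i2 := integrable_work (Lp.memLp qa) (Lp.memLp za) (Lp.memLp um.toFun)
  have i3 := integrable_energy h.memLp_k h.memLp_r (Lp.memLp u.toFun) (Lp.memLp ua.toFun)
  have i4 := integrable_energy h.memLp_k h.memLp_r (Lp.memLp um.toFun) (Lp.memLp ua.toFun)
  -- These move the time derivative from ũ onto u and u_m, where it cancels against the time terms
  -- of b(u, ũ) - b(u_m, ũ), which is R(ũ).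
  have p1 := u.integral_cdt_add_integral_cdt ua hT h.memLp_c hu.1 ha.final
  have p2 := um.integral_cdt_add_integral_cdt ua hT h.memLp_c hm.initial ha.final
  have key : ∫ t, (work (qa t) (za t) ((u.toFun - um.toFun : L2Time T (V Ω Γu)) t)
          - energy h.memLp_k h.memLp_r (ua.toFun t)
            ((u.toFun - um.toFun : L2Time T (V Ω Γu)) t)) ∂(timeMeasure T)
      = ((∫ t, work (qa t) (za t) (u.toFun t) ∂(timeMeasure T))
          - ∫ t, work (qa t) (za t) (um.toFun t) ∂(timeMeasure T))
        - ((∫ t, energy h.memLp_k h.memLp_r (u.toFun t) (ua.toFun t) ∂(timeMeasure T))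
          - ∫ t, energy h.memLp_k h.memLp_r (um.toFun t) (ua.toFun t) ∂(timeMeasure T)) := by
    rw [← integral_sub i1 i2, ← integral_sub i3 i4,
      ← integral_sub (by exact i1.sub i2) (by exact i3.sub i4)]
    refine integral_congr_ae ?_
    filter_upwards [Lp.coeFn_sub u.toFun um.toFun] with t ht
    rw [ht, Pi.sub_apply, work_sub, energy_comm, energy_sub_left]
  rw [key, ha.Q_eq, ha.Q_eq, R, ← hu.2, b_eq h.memLp_k h.memLp_r, b_eq h.memLp_k h.memLp_r]
  linarith

/-- The correction term is the residual at the adjoint approximation plus a shift. -/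
theorem Qcorr_eq_R_add_corrShift (h : AdmissibleCoefficients Ω c k r)
    (hm : IsPrimalAdmissible f g um qm zm) (hm_fin : HasFiniteCRE r um zm)
    (ha_fin : HasFiniteCRE r ua za) :
    Qcorr k r um qm zm ua qa za
      = R k r f g um ua.toFun + corrShift k r um qm zm ua qa za := by
  -- Primal equilibrium cancels the time derivative in l - b, so R(ũ) is the work of the primal gap
  -- on ũ.
  rw [Qcorr_eq (h := h) hm_fin ha_fin, corrShift_eq (h := h) hm_fin ha_fin, R, hm.l_eq,
    b_eq h.memLp_k h.memLp_r]
  ring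

/-- The bounds of the error on the output by the product of the constitutive relation errors. -/
theorem abs_output_error_le (hT : 0 < T) (h : AdmissibleCoefficients Ω c k r)
    (hu : IsWeakSolution k r f g u) (hm : IsPrimalAdmissible f g um qm zm)
    (hm_fin : HasFiniteCRE r um zm) (ha : IsAdjointAdmissible qS fS ua qa za)
    (ha_fin : HasFiniteCRE r ua za) :
    |Q qS fS u.toFun - Q qS fS um.toFun - R k r f g um ua.toFun|
        ≤ cre k r ua qa za * cre k r um qm zm ∧
      |Q qS fS u.toFun - Q qS fS um.toFun - Qcorr k r um qm zm ua qa za|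
        ≤ 1 / 2 * cre k r ua qa za * cre k r um qm zm := by
  -- Here A is the adjoint gap, B the primal gap and G = (k∇e, re) with e = u - u_m. Half of AB is
  -- the shift between the residual and the correction term, so AG - AB/2 is the corrected output
  -- error.
  have hform := abs_le_of_form_nonneg
    (gapForm_quadratic_nonneg (h := h) (q := qa) (q' := qm) ha_fin hm_fin
      (Lp.memLp (u.toFun - um.toFun : L2Time T (V Ω Γu))))
    (integral_energy_error_le hT h hu hm)
  rw [← Q_sub_Q_sub_R_eq hT h hu hm ha, ← cre_eq ha_fin, ← cre_eq hm_fin,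
    ← corrShift_eq hm_fin ha_fin] at hform
  rwa [Qcorr_eq_R_add_corrShift h hm hm_fin ha_fin, ← sub_sub]

end Bounds

end ParabolicCRE

end

theorem mainTheorem2 {d : ℕ} (hd : 1 ≤ d)
    -- space domain and its boundary parts, time interval
    (Ω Γu Γq : Set (E d)) (hΩ_open : IsOpen Ω) (hΩ_bdd : Bornology.IsBounded Ω)
    (hΩ_lip : HasLipschitzBoundary Ω)
    (hΓu_meas : MeasurableSet Γu) (hΓq_meas : MeasurableSet Γq) (hΓu_ne : Γu.Nonempty)
    (hΓ_disj : Disjoint Γu Γq) (hΓu_sub : Γu ⊆ frontier Ω) (hΓq_sub : Γq ⊆ frontier Ω)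
    (hΓ_cover : closure (Γu ∪ Γq) = frontier Ω)
    (T : ℝ) (hT : 0 < T)
    -- parameter domain and coefficients
    {np : ℕ} (P : Set (Fin np → ℝ)) (c k r : (Fin np → ℝ) → E d → ℝ)
    (hcoef : ∀ p ∈ P, AdmissibleCoefficients Ω (c p) (k p) (r p))
    -- loads and extractors
    (f : L2Time T (L2 Ω)) (g : L2Time T (Lp ℝ 2 ((surfaceMeasure Ω).restrict Γq)))
    (qS : (Fin np → ℝ) → L2Time T (L2Vec Ω)) (fS : (Fin np → ℝ) → L2Time T (L2 Ω))
    -- exact solution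
    (u : ∀ p, Evolution Ω Γu T (c p)) (hu : ∀ p ∈ P, IsWeakSolution (k p) (r p) f g (u p))
    -- admissible primal triplet
    (um : ∀ p, Evolution Ω Γu T (c p)) (qm : (Fin np → ℝ) → L2Time T (L2Vec Ω))
    (zm : (Fin np → ℝ) → L2Time T (L2 Ω))
    (hm : ∀ p ∈ P, IsPrimalAdmissible f g (um p) (qm p) (zm p))
    (hm_fin : ∀ p ∈ P, HasFiniteCRE (r p) (um p) (zm p))
    -- admissible adjoint triplet
    (ua : ∀ p, Evolution Ω Γu T (c p)) (qa : (Fin np → ℝ) → L2Time T (L2Vec Ω))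
    (za : (Fin np → ℝ) → L2Time T (L2 Ω))
    (ha : ∀ p ∈ P, IsAdjointAdmissible (qS p) (fS p) (ua p) (qa p) (za p))
    (ha_fin : ∀ p ∈ P, HasFiniteCRE (r p) (ua p) (za p)) :
    ∀ p ∈ P,
      |Q (qS p) (fS p) (u p).toFun - Q (qS p) (fS p) (um p).toFun
          - R (k p) (r p) f g (um p) (ua p).toFun|
        ≤ cre (k p) (r p) (ua p) (qa p) (za p) * cre (k p) (r p) (um p) (qm p) (zm p) ∧
      Qcorr (k p) (r p) (um p) (qm p) (zm p) (ua p) (qa p) (za p)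
        = R (k p) (r p) f g (um p) (ua p).toFun
          + corrShift (k p) (r p) (um p) (qm p) (zm p) (ua p) (qa p) (za p) ∧
      |Q (qS p) (fS p) (u p).toFun - Q (qS p) (fS p) (um p).toFun
          - Qcorr (k p) (r p) (um p) (qm p) (zm p) (ua p) (qa p) (za p)|
        ≤ 1 / 2 * cre (k p) (r p) (ua p) (qa p) (za p)
            * cre (k p) (r p) (um p) (qm p) (zm p) := by
  intro p hp
  obtain ⟨h1, h2⟩ := abs_output_error_le hT (hcoef p hp) (hu p hp) (hm p hp) (hm_fin p hp)
    (ha p hp) (ha_fin p hp)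
  exact ⟨h1, Qcorr_eq_R_add_corrShift (hcoef p hp) (hm p hp) (hm_fin p hp) (ha_fin p hp), h2⟩
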